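/- **Proposition 2.1.** Let $k$ be a commutative ring and $G$ a group; $\otimes$ means $\otimes_k$, and $k$-algebras are associative but need not have a unit. *Conventions.* For a $k$-algebra $A$, a left $A$-module $M$ (a $k$-module on which $A$ acts $k$-bilinearly) is *unital* if the canonical map $A\otimes_A M\to M$ is an isomorphism, and similarly for right modules; $A$ is *unital* if $A\otimes_A A\to A$ is an isomorphism. Write $A^{\rm e}=A\otimes A^{\rm op}$; it acts on $A$ by $(a\otimes b)x=axb$. A *Taylor–Azumaya algebra* is a unital $k$-algebra $A$, faithful as a $k$-module, such that the adjoint functors $N\mapsto A\otimes N$, from $k$-modules to unital left $A^{\rm e}$-modules, and $M\mapsto \mathrm{Hom}_{A^{\rm e}}(A,M)$ in the other direction are inverse equivalences (the unit and the counit of the adjunction are isomorphisms). A *$G$-module algebra* is a $k$-algebra on which $G$ acts by $k$-algebra automorphisms; tensor products carry the diagonal action, opposite algebras the same action. A *$G$-module Taylor–Azumaya algebra* is a Taylor–Azumaya algebra that is also a $G$-module algebra. A *dual pair of $G$-modules* $\underline M=(M,M',\mu)$ consists of $k$-modules $M,M'$ with $k$-linear $G$-actions and a surjective $k$-linear map $\mu:M'\otimes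 M\to k$ with $\mu(g m'\otimes g m)=\mu(m'\otimes m)$ for all $g\in G$, $m\in M$, $m'\in M'$. Its algebra is $E(\underline M)=M\otimes M'$ with product $(m\otimes m')(n\otimes n')=\mu(m'\otimes n)\,m\otimes n'$ and diagonal $G$-action. A $G$-module algebra is *elementary* if it is isomorphic, as a $G$-module algebra, to some $E(\underline M)$. Unital $G$-module algebras $A$ and $B$ are *Morita equivalent as $G$-module algebras* if there are an $A$-$B$-bimodule $P$ and a $B$-$A$-bimodule $Q$, unital on both sides and with $k$-linear $G$-actions satisfying $g(xy)=(gx)(gy)$ for the left and right module actions, and $G$-equivariant bimodule isomorphisms $f:P\otimes_B Q\to A$ and $h:Q\otimes_A P\to B$ with $f(p\otimes q)p'=p\,h(q\otimes p')$ and $h(q\otimes p)q'=q\,f(p\otimes q')$ for all $p,p'\in P$, $q,q'\in Q$. *Statement.* Let $A$ and $B$ be $G$-module Taylor–Azumaya algebras over $k$. The following assertions are equivalent: 1. $A$ and $B$ are Morita equivalent as $G$-module algebras; 2. $A\otimes B^{\rm op}$ is an elementary $G$-module algebra; 3. there exist dual pairs of $G$-modules $\underline M$ and $\underline N$ such that $A\otimes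 E(\underline M)\cong B\otimes E(\underline N)$ as $G$-module algebras. -/

import Mathlib

open scoped TensorProduct

universe u v

namespace EquivariantBrauer

/-! ### Modules over algebras without unit

A `k`-algebra `A`, not necessarily with unit, is given by
`[NonUnitalRing A] [Module k A] [IsScalarTower k A A] [SMulCommClass k A A]`.
A left `A`-module is a `k`-module `M` with a `k`-algebra map `ρ : A →ₙₐ[k] Module.End k M`, where
`a` acts on `m` as `ρ a m`; a right `A`-module is the same with `Aᵐᵒᵖ` in place of `A`. -/

section Modules

variable {k A : Type*} [CommRing k]
  [NonUnitalRing A] [Module k A] [IsScalarTower k A A] [SMulCommClass k A A]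
  {P Q M : Type*} [AddCommGroup P] [Module k P] [AddCommGroup Q] [Module k Q]
  [AddCommGroup M] [Module k M]

variable (k A) in
/-- `A` as a right module over itself. -/
def rightRegular : Aᵐᵒᵖ →ₙₐ[k] Module.End k A where
  toFun b := LinearMap.mulRight k b.unop
  map_smul' c b := by ext x; simp [mul_smul_comm]
  map_zero' := by ext x; simp
  map_add' b c := by ext x; simp [mul_add]
  map_mul' b c := by ext x; simp [mul_assoc]

/-- The relations `p a ⊗ q = p ⊗ a q` in `P ⊗ Q`. -/
def balancedRelations (σ : Aᵐᵒᵖ →ₙₐ[k] Module.End k P) (ρ : A →ₙₐ[k] Module.End k Q) :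
    Submodule k (P ⊗[k] Q) :=
  Submodule.span k
    {x | ∃ (a : A) (p : P) (q : Q), x = σ (MulOpposite.op a) p ⊗ₜ[k] q - p ⊗ₜ[k] ρ a q}

/-- The tensor product `P ⊗_A Q` of a right `A`-module `P` and a left `A`-module `Q`. -/
abbrev BalancedTensor (σ : Aᵐᵒᵖ →ₙₐ[k] Module.End k P) (ρ : A →ₙₐ[k] Module.End k Q) : Type _ :=
  (P ⊗[k] Q) ⧸ balancedRelations σ ρ

/-- The class of `p ⊗ q` in `P ⊗_A Q`. -/
def btmul (σ : Aᵐᵒᵖ →ₙₐ[k] Module.End k P) (ρ : A →ₙₐ[k] Module.End k Q) (p : P) (q : Q) :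
    BalancedTensor σ ρ :=
  (balancedRelations σ ρ).mkQ (p ⊗ₜ[k] q)

/-- The linear map out of `P ⊗_A Q` induced by a balanced bilinear map. -/
def balancedLift {R : Type*} [AddCommGroup R] [Module k R]
    (σ : Aᵐᵒᵖ →ₙₐ[k] Module.End k P) (ρ : A →ₙₐ[k] Module.End k Q) (f : P →ₗ[k] Q →ₗ[k] R)
    (hf : ∀ (a : A) (p : P) (q : Q), f (σ (MulOpposite.op a) p) q = f p (ρ a q)) :
    BalancedTensor σ ρ →ₗ[k] R :=
  have h : balancedRelations σ ρ ≤ LinearMap.ker (TensorProduct.lift f) := by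
    unfold balancedRelations
    refine Submodule.span_le.2 ?_
    rintro _ ⟨a, p, q, rfl⟩
    simp [hf]
  (balancedRelations σ ρ).liftQ (TensorProduct.lift f) h

theorem balancedLift_btmul {R : Type*} [AddCommGroup R] [Module k R]
    (σ : Aᵐᵒᵖ →ₙₐ[k] Module.End k P) (ρ : A →ₙₐ[k] Module.End k Q) (f : P →ₗ[k] Q →ₗ[k] R)
    (hf : ∀ (a : A) (p : P) (q : Q), f (σ (MulOpposite.op a) p) q = f p (ρ a q)) (p : P) (q : Q) :
    balancedLift σ ρ f hf (btmul σ ρ p q) = f p q := rfl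

/-- The canonical map `A ⊗_A M → M`, `a ⊗ m ↦ a m`. -/
def leftCanonical (ρ : A →ₙₐ[k] Module.End k M) :
    BalancedTensor (rightRegular k A) ρ →ₗ[k] M :=
  balancedLift (rightRegular k A) ρ (ρ : A →ₗ[k] Module.End k M) (by
    intro a b m
    simp [rightRegular])

theorem leftCanonical_btmul (ρ : A →ₙₐ[k] Module.End k M) (a : A) (m : M) :
    leftCanonical ρ (btmul (rightRegular k A) ρ a m) = ρ a m := rfl

/-- The canonical map `M ⊗_A A → M`, `m ⊗ a ↦ m a`. -/
def rightCanonical (σ : Aᵐᵒᵖ →ₙₐ[k] Module.End k M) :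
    BalancedTensor σ (NonUnitalAlgHom.lmul k A) →ₗ[k] M :=
  balancedLift σ (NonUnitalAlgHom.lmul k A)
    ((σ : Aᵐᵒᵖ →ₗ[k] Module.End k M) ∘ₗ
      (MulOpposite.opLinearEquiv k : A ≃ₗ[k] Aᵐᵒᵖ).toLinearMap).flip (by
    intro a m b
    simp)

theorem rightCanonical_btmul (σ : Aᵐᵒᵖ →ₙₐ[k] Module.End k M) (m : M) (a : A) :
    rightCanonical σ (btmul σ (NonUnitalAlgHom.lmul k A) m a) = σ (MulOpposite.op a) m := rfl

/-- The left module `M` is unital: `A ⊗_A M → M` is an isomorphism. -/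
def IsUnitalLeft (ρ : A →ₙₐ[k] Module.End k M) : Prop :=
  Function.Bijective (leftCanonical ρ)

/-- The right module `M` is unital: `M ⊗_A A → M` is an isomorphism. -/
def IsUnitalRight (σ : Aᵐᵒᵖ →ₙₐ[k] Module.End k M) : Prop :=
  Function.Bijective (rightCanonical σ)

variable (k A) in
/-- The algebra `A` is unital: `A ⊗_A A → A` is an isomorphism. -/
def IsUnitalAlgebra : Prop :=
  IsUnitalLeft (NonUnitalAlgHom.lmul k A)

/-- The `k`-module `Hom_A(P, Q)` of left `A`-linear maps. -/
def homModule (ρ : A →ₙₐ[k] Module.End k P) (τ : A →ₙₐ[k] Module.End k Q) :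
    Submodule k (P →ₗ[k] Q) where
  carrier := {f | ∀ (a : A) (p : P), f (ρ a p) = τ a (f p)}
  add_mem' hf hg a p := by simp [hf a p, hg a p]
  zero_mem' a p := by simp
  smul_mem' c f hf a p := by simp [hf a p]

/-- The left `A`-module `P ⊗ N`, for a left `A`-module `P` and a `k`-module `N`. -/
noncomputable def tensorAction (ρ : A →ₙₐ[k] Module.End k P) (N : Type*) [AddCommGroup N]
    [Module k N] : A →ₙₐ[k] Module.End k (P ⊗[k] N) where
  toFun a := (ρ a).rTensor N
  map_smul' c a := by simp [LinearMap.rTensor_smul]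
  map_zero' := by simp
  map_add' a b := by simp [LinearMap.rTensor_add]
  map_mul' a b := by simp [LinearMap.rTensor_mul]

theorem tensorAction_tmul (ρ : A →ₙₐ[k] Module.End k P) (N : Type*) [AddCommGroup N]
    [Module k N] (a : A) (p : P) (n : N) :
    tensorAction ρ N a (p ⊗ₜ[k] n) = ρ a p ⊗ₜ[k] n := rfl

/-- The unit `N → Hom_A(P, P ⊗ N)`, `n ↦ (p ↦ p ⊗ n)`, of the adjunction between `P ⊗ -` and
`Hom_A(P, -)`. -/
noncomputable def adjUnit (ρ : A →ₙₐ[k] Module.End k P) (N : Type*) [AddCommGroup N]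
    [Module k N] : N →ₗ[k] homModule ρ (tensorAction ρ N) :=
  LinearMap.codRestrict _ (TensorProduct.mk k P N).flip (by
    intro n a p
    simp [tensorAction])

theorem adjUnit_apply (ρ : A →ₙₐ[k] Module.End k P) (N : Type*) [AddCommGroup N]
    [Module k N] (n : N) (p : P) : (adjUnit ρ N n : P →ₗ[k] P ⊗[k] N) p = p ⊗ₜ[k] n := rfl

/-- The counit `P ⊗ Hom_A(P, M) → M`, `p ⊗ f ↦ f p`, of the adjunction between `P ⊗ -` and
`Hom_A(P, -)`. -/
noncomputable def adjCounit (ρ : A →ₙₐ[k] Module.End k P) (τ : A →ₙₐ[k] Module.End k M) :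
    P ⊗[k] homModule ρ τ →ₗ[k] M :=
  TensorProduct.lift (homModule ρ τ).subtype.flip

theorem adjCounit_tmul (ρ : A →ₙₐ[k] Module.End k P) (τ : A →ₙₐ[k] Module.End k M)
    (p : P) (f : homModule ρ τ) : adjCounit ρ τ (p ⊗ₜ[k] f) = (f : P →ₗ[k] M) p := rfl

end Modules

/-! ### Taylor–Azumaya algebras -/

section TaylorAzumaya

variable (k A : Type u) [CommRing k]
  [NonUnitalRing A] [Module k A] [IsScalarTower k A A] [SMulCommClass k A A]

/-- `A` as a left module over the enveloping algebra `Aᵉ = A ⊗ Aᵒᵖ`: `(a ⊗ b) x = a x b`. -/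
noncomputable def envAction : A ⊗[k] Aᵐᵒᵖ →ₙₐ[k] Module.End k A :=
  let f : A ⊗[k] Aᵐᵒᵖ →ₗ[k] Module.End k A :=
    TensorProduct.lift (LinearMap.mk₂ k
      (fun (a : A) (b : Aᵐᵒᵖ) => LinearMap.mulLeft k a ∘ₗ LinearMap.mulRight k b.unop)
      (fun a a' b => by ext x; simp [add_mul])
      (fun c a b => by ext x; simp [smul_mul_assoc])
      (fun a b b' => by ext x; simp [mul_add])
      (fun c a b => by ext x; simp [mul_smul_comm]))
  { f with
    map_zero' := map_zero f
    map_mul' := fun x y => by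
      change f (x * y) = f x * f y
      induction x with
      | zero => simp
      | add x x' hx hx' => simp [add_mul, hx, hx']
      | tmul a b =>
        induction y with
        | zero => simp
        | add y y' hy hy' => simp [mul_add, hy, hy']
        | tmul a' b' => ext x; simp [f, mul_assoc] }

theorem envAction_tmul (a : A) (b : Aᵐᵒᵖ) (x : A) :
    envAction k A (a ⊗ₜ[k] b) x = a * (x * b.unop) := rfl

/-- `A` is a Taylor–Azumaya algebra: `A` is unital and faithful over `k`, and the adjoint functors
`F N = A ⊗ N`, from `k`-modules to unital left `Aᵉ`-modules, and `H M = Hom_{Aᵉ}(A, M)` are inverse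
equivalences, that is, the unit and the counit of the adjunction are isomorphisms. -/
structure IsTaylorAzumaya : Prop where
  unital : IsUnitalAlgebra k A
  faithful : FaithfulSMul k A
  unit_bijective : ∀ (N : Type u) [AddCommGroup N] [Module k N],
    Function.Bijective (adjUnit (envAction k A) N)
  counit_bijective : ∀ (M : Type u) [AddCommGroup M] [Module k M]
    (τ : A ⊗[k] Aᵐᵒᵖ →ₙₐ[k] Module.End k M), IsUnitalLeft τ →
    Function.Bijective (adjCounit (envAction k A) τ)

end TaylorAzumaya

/-! ### `G`-module algebras -/

/-- An action of the group `G` on the `k`-algebra `A` by `k`-algebra automorphisms: this makes `A`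
a `G`-module algebra. -/
structure AlgAction (k G A : Type*) [CommRing k] [Group G] [NonUnitalRing A] [Module k A] where
  rep : Representation k G A
  map_mul : ∀ (g : G) (a b : A), rep g (a * b) = rep g a * rep g b

section AlgAction

variable {k G : Type*} [CommRing k] [Group G] {A B : Type*}
  [NonUnitalRing A] [Module k A]
  [NonUnitalRing B] [Module k B]

/-- The diagonal action on `A ⊗ B`. -/
noncomputable def AlgAction.tensor [IsScalarTower k A A] [SMulCommClass k A A]
    [IsScalarTower k B B] [SMulCommClass k B B]
    (α : AlgAction k G A) (β : AlgAction k G B) : AlgAction k G (A ⊗[k] B) where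
  rep := α.rep.tprod β.rep
  map_mul g x y := by
    induction x with
    | zero => simp
    | add x x' hx hx' => simp only [add_mul, map_add, hx, hx']
    | tmul a b =>
      induction y with
      | zero => simp
      | add y y' hy hy' => simp only [mul_add, map_add, hy, hy']
      | tmul a' b' => simp [α.map_mul, β.map_mul]

/-- The opposite algebra, with the same action. -/
def AlgAction.op (α : AlgAction k G A) : AlgAction k G Aᵐᵒᵖ where
  rep :=
    { toFun := fun g => (MulOpposite.opLinearEquiv k).toLinearMap ∘ₗ α.rep g ∘ₗ
        (MulOpposite.opLinearEquiv k).symm.toLinearMap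
      map_one' := by ext x; simp
      map_mul' := fun g h => by ext x; simp }
  map_mul g a b := by simp [α.map_mul]

/-- An isomorphism of `G`-module algebras. -/
structure AlgAction.Iso (α : AlgAction k G A) (β : AlgAction k G B) where
  toEquiv : A ≃ₗ[k] B
  map_mul : ∀ a b : A, toEquiv (a * b) = toEquiv a * toEquiv b
  equivariant : ∀ (g : G) (a : A), toEquiv (α.rep g a) = β.rep g (toEquiv a)

end AlgAction

/-! ### Elementary algebras -/

/-- A dual pair of `k`-modules `(M, M', μ)`, with `μ : M' ⊗ M → k` surjective. -/
structure DualPair (k : Type u) [CommRing k] where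
  M : Type u
  M' : Type u
  [addCommGroupM : AddCommGroup M]
  [moduleM : Module k M]
  [addCommGroupM' : AddCommGroup M']
  [moduleM' : Module k M']
  μ : M' ⊗[k] M →ₗ[k] k
  surjective : Function.Surjective μ

attribute [instance] DualPair.addCommGroupM DualPair.moduleM
  DualPair.addCommGroupM' DualPair.moduleM'

section Elementary

variable {k : Type u} [CommRing k]

/-- The `k`-module `M ⊗ M'` underlying the elementary algebra of the dual pair `(M, M', μ)`. -/
def Elem (p : DualPair k) : Type u := p.M ⊗[k] p.M'

noncomputable instance (p : DualPair k) : AddCommGroup (Elem p) :=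
  inferInstanceAs (AddCommGroup (p.M ⊗[k] p.M'))

noncomputable instance (p : DualPair k) : Module k (Elem p) :=
  inferInstanceAs (Module k (p.M ⊗[k] p.M'))

/-- The element `m ⊗ m'` of the elementary algebra. -/
def Elem.tmul (p : DualPair k) (m : p.M) (m' : p.M') : Elem p := m ⊗ₜ[k] m'

/-- The action of `M ⊗ M'` on `M`: `(m ⊗ m') n = μ(m' ⊗ n) m`. -/
noncomputable def Elem.act (p : DualPair k) : p.M ⊗[k] p.M' →ₗ[k] Module.End k p.M :=
  TensorProduct.lift (LinearMap.mk₂ k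
    (fun m m' => LinearMap.toSpanSingleton k p.M m ∘ₗ p.μ ∘ₗ TensorProduct.mk k p.M' p.M m')
    (fun m n m' => by ext x; simp)
    (fun c m m' => by ext x; simp [smul_comm c])
    (fun m m' n' => by ext x; simp [add_smul])
    (fun c m m' => by ext x; simp [mul_smul]))

/-- The multiplication of the elementary algebra, as a bilinear map:
`(m ⊗ m') (n ⊗ n') = ((m ⊗ m') n) ⊗ n'`. -/
noncomputable def Elem.mulBilin (p : DualPair k) :
    p.M ⊗[k] p.M' →ₗ[k] p.M ⊗[k] p.M' →ₗ[k] p.M ⊗[k] p.M' :=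
  LinearMap.rTensorHom p.M' ∘ₗ Elem.act p

noncomputable instance (p : DualPair k) : Mul (Elem p) where
  mul x y := Elem.mulBilin p x y

theorem Elem.mul_def (p : DualPair k) (x y : Elem p) : x * y = Elem.mulBilin p x y := rfl

/-- The defining formula `(m ⊗ m') (n ⊗ n') = μ(m' ⊗ n) m ⊗ n'`. -/
theorem Elem.tmul_mul_tmul (p : DualPair k) (m n : p.M) (m' n' : p.M') :
    Elem.tmul p m m' * Elem.tmul p n n' = p.μ (m' ⊗ₜ[k] n) • Elem.tmul p m n' := by
  change (p.μ (m' ⊗ₜ[k] n) • m) ⊗ₜ[k] n' = p.μ (m' ⊗ₜ[k] n) • (m ⊗ₜ[k] n')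
  rw [TensorProduct.smul_tmul']

theorem Elem.act_mul (p : DualPair k) (x y : p.M ⊗[k] p.M') :
    Elem.act p (Elem.mulBilin p x y) = Elem.act p x * Elem.act p y := by
  induction y with
  | zero => simp
  | add y y' hy hy' => simp only [map_add, mul_add, hy, hy']
  | tmul n n' => ext l; simp [Elem.mulBilin, Elem.act]

/-- The elementary algebra `E(M)` of a dual pair. -/
noncomputable instance (p : DualPair k) : NonUnitalRing (Elem p) where
  left_distrib x y z := map_add (Elem.mulBilin p x) y z
  right_distrib x y z := LinearMap.map_add₂ (Elem.mulBilin p) x y z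
  zero_mul x := LinearMap.map_zero₂ (Elem.mulBilin p) x
  mul_zero x := map_zero (Elem.mulBilin p x)
  mul_assoc x y z := by
    change (Elem.act p (Elem.mulBilin p x y)).rTensor p.M' z =
      (Elem.act p x).rTensor p.M' ((Elem.act p y).rTensor p.M' z)
    exact (congrArg (fun e : Module.End k p.M => e.rTensor p.M' z) (Elem.act_mul p x y)).trans
      (LinearMap.rTensor_comp_apply p.M' (Elem.act p x) (Elem.act p y) z)

instance (p : DualPair k) : IsScalarTower k (Elem p) (Elem p) where
  smul_assoc c x y := LinearMap.map_smul₂ (Elem.mulBilin p) c x y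

instance (p : DualPair k) : SMulCommClass k (Elem p) (Elem p) where
  smul_comm c x y := (map_smul (Elem.mulBilin p x) c y).symm

end Elementary

/-- A dual pair of `G`-modules: `M` and `M'` are `G`-modules and
`μ(g m' ⊗ g m) = μ(m' ⊗ m)`. -/
structure GDualPair (k : Type u) [CommRing k] (G : Type v) [Group G] extends DualPair k where
  rep : Representation k G M
  rep' : Representation k G M'
  invariant : ∀ (g : G) (m' : M') (m : M), μ (rep' g m' ⊗ₜ[k] rep g m) = μ (m' ⊗ₜ[k] m)

section GElementary

variable {k : Type u} [CommRing k] {G : Type v} [Group G]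

/-- The diagonal action of `G` on `M ⊗ M'`. -/
noncomputable def GDualPair.elemRep (p : GDualPair k G) : Representation k G (Elem p.toDualPair) :=
  (p.rep.tprod p.rep' : Representation k G (p.M ⊗[k] p.M'))

/-- The elementary `G`-module algebra `E(M)` of a dual pair of `G`-modules. -/
noncomputable def GDualPair.algAction (p : GDualPair k G) : AlgAction k G (Elem p.toDualPair) where
  rep := p.elemRep
  map_mul g x y := by
    change TensorProduct.map (p.rep g) (p.rep' g) (Elem.mulBilin p.toDualPair x y) =
      Elem.mulBilin p.toDualPair (TensorProduct.map (p.rep g) (p.rep' g) x)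
        (TensorProduct.map (p.rep g) (p.rep' g) y)
    change p.M ⊗[k] p.M' at x y
    induction x with
    | zero => simp
    | add x x' hx hx' => simp only [map_add, LinearMap.add_apply, hx, hx']
    | tmul a b =>
      induction y with
      | zero => simp
      | add y y' hy hy' => simp only [map_add, hy, hy']
      | tmul a' b' => simp [Elem.mulBilin, Elem.act, p.invariant]

/-- A `G`-module algebra is elementary if it is isomorphic, as a `G`-module algebra, to `E(M)` for
some dual pair `M` of `G`-modules. -/
def IsElementary {A : Type*} [NonUnitalRing A] [Module k A] (α : AlgAction k G A) : Prop :=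
  ∃ p : GDualPair k G, Nonempty (α.Iso p.algAction)

end GElementary

/-! ### Equivariant Morita equivalence -/

section Morita

variable {k : Type u} [CommRing k] {G : Type v} [Group G]

/-- An `A`-`B`-bimodule, unital on both sides, with a compatible action of `G`. -/
structure GBimodule {A B : Type u}
    [NonUnitalRing A] [Module k A] [IsScalarTower k A A] [SMulCommClass k A A]
    [NonUnitalRing B] [Module k B] [IsScalarTower k B B] [SMulCommClass k B B]
    (α : AlgAction k G A) (β : AlgAction k G B) where
  carrier : Type u
  [addCommGroup : AddCommGroup carrier]
  [module : Module k carrier]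
  left : A →ₙₐ[k] Module.End k carrier
  right : Bᵐᵒᵖ →ₙₐ[k] Module.End k carrier
  comm : ∀ (a : A) (b : Bᵐᵒᵖ) (p : carrier), left a (right b p) = right b (left a p)
  unital_left : IsUnitalLeft left
  unital_right : IsUnitalRight right
  rep : Representation k G carrier
  rep_left : ∀ (g : G) (a : A) (p : carrier), rep g (left a p) = left (α.rep g a) (rep g p)
  rep_right : ∀ (g : G) (b : B) (p : carrier),
    rep g (right (MulOpposite.op b) p) = right (MulOpposite.op (β.rep g b)) (rep g p)

attribute [instance] GBimodule.addCommGroup GBimodule.module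

/-- A strict `G`-equivariant Morita context connecting `A` and `B`: bimodules `P = {}_A P_B` and
`Q = {}_B Q_A`, and `G`-equivariant bimodule isomorphisms `f : P ⊗_B Q → A` and
`h : Q ⊗_A P → B`, such that `f(p ⊗ q) p' = p h(q ⊗ p')` and `h(q ⊗ p) q' = q f(p ⊗ q')`. -/
structure StrictGMoritaContext {A B : Type u}
    [NonUnitalRing A] [Module k A] [IsScalarTower k A A] [SMulCommClass k A A]
    [NonUnitalRing B] [Module k B] [IsScalarTower k B B] [SMulCommClass k B B]
    (α : AlgAction k G A) (β : AlgAction k G B) where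
  P : GBimodule α β
  Q : GBimodule β α
  f : BalancedTensor P.right Q.left →ₗ[k] A
  h : BalancedTensor Q.right P.left →ₗ[k] B
  f_left : ∀ (a : A) (p : P.carrier) (q : Q.carrier),
    f (btmul P.right Q.left (P.left a p) q) = a * f (btmul P.right Q.left p q)
  f_right : ∀ (a : A) (p : P.carrier) (q : Q.carrier),
    f (btmul P.right Q.left p (Q.right (MulOpposite.op a) q)) = f (btmul P.right Q.left p q) * a
  h_left : ∀ (b : B) (q : Q.carrier) (p : P.carrier),
    h (btmul Q.right P.left (Q.left b q) p) = b * h (btmul Q.right P.left q p)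
  h_right : ∀ (b : B) (q : Q.carrier) (p : P.carrier),
    h (btmul Q.right P.left q (P.right (MulOpposite.op b) p)) = h (btmul Q.right P.left q p) * b
  f_equivariant : ∀ (g : G) (p : P.carrier) (q : Q.carrier),
    f (btmul P.right Q.left (P.rep g p) (Q.rep g q)) = α.rep g (f (btmul P.right Q.left p q))
  h_equivariant : ∀ (g : G) (q : Q.carrier) (p : P.carrier),
    h (btmul Q.right P.left (Q.rep g q) (P.rep g p)) = β.rep g (h (btmul Q.right P.left q p))
  assoc_P : ∀ (p : P.carrier) (q : Q.carrier) (p' : P.carrier),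
    P.left (f (btmul P.right Q.left p q)) p' =
      P.right (MulOpposite.op (h (btmul Q.right P.left q p'))) p
  assoc_Q : ∀ (q : Q.carrier) (p : P.carrier) (q' : Q.carrier),
    Q.left (h (btmul Q.right P.left q p)) q' =
      Q.right (MulOpposite.op (f (btmul P.right Q.left p q'))) q
  f_bijective : Function.Bijective f
  h_bijective : Function.Bijective h

end Morita

end EquivariantBrauer

/-!
Unital modules are handled through the universal property of `A ⊗_A M` (`IsFirm`), which takes
the place of unit elements.

Morita contexts compose and can be tensored with each other. A dual pair gives a context between
`k` and `E(M)`, hence one between `A` and `A ⊗ E(M)`, and so `A ⊗ E(M) ≅ B ⊗ E(N)` yields an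
equivalence between `A` and `B`.

Conversely, let `(P, Q)` be a context between a Taylor–Azumaya algebra `A` and a unital algebra `B`.
The counit at `A ⊗ Q` identifies `A ⊗ P'` with `A ⊗ Q`, where `P' = Hom_{Aᵉ}(A, A ⊗ Q)`, and
applying `P ⊗_A -` gives `P ⊗ P' ≅ A ⊗ Bᵒᵖ`. The endomorphisms of the bimodule `P` are the
scalars, so the action of `A ⊗ Bᵒᵖ` on `P` is given by a pairing `P' ⊗ P → k`, which turns this
isomorphism into `E(P, P') ≅ A ⊗ Bᵒᵖ`. For `P = Q = A` it shows that `A ⊗ Aᵒᵖ` is elementary, and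
`A ⊗ (B ⊗ Aᵒᵖ) ≅ B ⊗ (A ⊗ Aᵒᵖ)` leads from `A ⊗ Bᵒᵖ` being elementary to the third assertion.
-/

namespace EquivariantBrauer

/-! ### Generating bilinear maps and balanced tensor products -/

section Generates

variable {k : Type*} [CommRing k] {X Y Z W : Type*} [AddCommGroup X] [Module k X]
  [AddCommGroup Y] [Module k Y] [AddCommGroup Z] [Module k Z] [AddCommGroup W] [Module k W]

/-- The values of the bilinear map `β` span its codomain. -/
def Generates (β : X →ₗ[k] Y →ₗ[k] Z) : Prop :=
  ∀ S : Submodule k Z, (∀ x y, β x y ∈ S) → ∀ z, z ∈ S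

namespace Generates

variable {β : X →ₗ[k] Y →ₗ[k] Z} (hβ : Generates β)

include hβ

theorem ext {f g : Z →ₗ[k] W} (h : ∀ x y, f (β x y) = g (β x y)) : f = g :=
  LinearMap.ext (hβ (LinearMap.eqLocus f g) h)

theorem surjective {f : W →ₗ[k] Z} (h : ∀ x y, ∃ w, f w = β x y) : Function.Surjective f :=
  hβ (LinearMap.range f) h

@[elab_as_elim]
theorem induction {motive : Z → Prop} (apply : ∀ x y, motive (β x y))
    (add : ∀ z z', motive z → motive z' → motive (z + z')) (z : Z) : motive z := by
  let S : Submodule k Z :=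
    { AddSubmonoid.closure {z | ∃ x y, β x y = z} with
      smul_mem' := fun c z hz => by
        induction hz using AddSubmonoid.closure_induction with
        | mem z hz =>
          obtain ⟨x, y, rfl⟩ := hz
          exact AddSubmonoid.subset_closure ⟨c • x, y, by simp⟩
        | zero => simp
        | add z z' _ _ hz hz' => rw [smul_add]; exact AddSubmonoid.add_mem _ hz hz' }
  have hz : z ∈ AddSubmonoid.closure {z | ∃ x y, β x y = z} :=
    hβ S (fun x y => AddSubmonoid.subset_closure ⟨x, y, rfl⟩) z
  induction hz using AddSubmonoid.closure_induction with
  | mem z hz => obtain ⟨x, y, rfl⟩ := hz; exact apply x y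
  | zero => simpa using apply 0 0
  | add z z' _ _ hz hz' => exact add z z' hz hz'

end Generates

theorem generates_mk : Generates (TensorProduct.mk k X Y) := fun S hS z => by
  induction z with
  | zero => exact S.zero_mem
  | add x y hx hy => exact S.add_mem hx hy
  | tmul x y => exact hS x y

end Generates

namespace BalancedTensor

variable {k A : Type*} [CommRing k] [NonUnitalRing A] [Module k A]
  {P Q : Type*} [AddCommGroup P] [Module k P] [AddCommGroup Q] [Module k Q]
  (σ : Aᵐᵒᵖ →ₙₐ[k] Module.End k P) (ρ : A →ₙₐ[k] Module.End k Q)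

/-- The canonical bilinear map `P × Q → P ⊗_A Q`; its values are the classes `btmul σ ρ p q`. -/
def mk : P →ₗ[k] Q →ₗ[k] BalancedTensor σ ρ :=
  (TensorProduct.mk k P Q).compr₂ (balancedRelations σ ρ).mkQ

theorem generates_mk : Generates (mk σ ρ) := fun S hS z => by
  obtain ⟨t, rfl⟩ := Submodule.mkQ_surjective _ z
  exact EquivariantBrauer.generates_mk (S.comap (balancedRelations σ ρ).mkQ) hS t

variable {σ ρ} in
@[elab_as_elim, induction_eliminator]
theorem induction_on {motive : BalancedTensor σ ρ → Prop} (mk : ∀ p q, motive (mk σ ρ p q))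
    (add : ∀ x y, motive x → motive y → motive (x + y)) (x : BalancedTensor σ ρ) : motive x :=
  (generates_mk σ ρ).induction mk add x

theorem mk_balanced (a : A) (p : P) (q : Q) :
    mk σ ρ (σ (MulOpposite.op a) p) q = mk σ ρ p (ρ a q) :=
  (Submodule.Quotient.eq _).2 (Submodule.subset_span ⟨a, p, q, rfl⟩)

@[simp]
theorem lift_mk {R : Type*} [AddCommGroup R] [Module k R] (f : P →ₗ[k] Q →ₗ[k] R)
    (hf : ∀ (a : A) (p : P) (q : Q), f (σ (MulOpposite.op a) p) q = f p (ρ a q)) (p : P) (q : Q) :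
    balancedLift σ ρ f hf (mk σ ρ p q) = f p q := rfl

section Map

variable {B P' Q' : Type*} [NonUnitalRing B] [Module k B] [AddCommGroup P'] [Module k P']
  [AddCommGroup Q'] [Module k Q']
  {σ} {ρ} {σ' : Bᵐᵒᵖ →ₙₐ[k] Module.End k P'} {ρ' : B →ₙₐ[k] Module.End k Q'}

/-- The map `P ⊗_A Q → P' ⊗_B Q'` induced by maps `P → P'` and `Q → Q'` that are semilinear with
respect to the same map `A → B`. -/
def map (t : A → B) (f : P →ₗ[k] P') (g : Q →ₗ[k] Q')
    (hf : ∀ a p, f (σ (MulOpposite.op a) p) = σ' (MulOpposite.op (t a)) (f p))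
    (hg : ∀ a q, g (ρ a q) = ρ' (t a) (g q)) : BalancedTensor σ ρ →ₗ[k] BalancedTensor σ' ρ' :=
  balancedLift σ ρ ((mk σ' ρ').compl₁₂ f g) fun a p q => by
    simp only [LinearMap.compl₁₂_apply, hf, hg, mk_balanced]

@[simp]
theorem map_mk (t : A → B) (f : P →ₗ[k] P') (g : Q →ₗ[k] Q')
    (hf : ∀ a p, f (σ (MulOpposite.op a) p) = σ' (MulOpposite.op (t a)) (f p))
    (hg : ∀ a q, g (ρ a q) = ρ' (t a) (g q)) (p : P) (q : Q) :
    map t f g hf hg (mk σ ρ p q) = mk σ' ρ' (f p) (g q) := rfl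

end Map

section Action

variable {C : Type*} [NonUnitalRing C] [Module k C]

/-- The action of `C` on `P ⊗_A Q` through an action on `P` by `A`-linear maps. -/
def leftAction (τ : C →ₙₐ[k] Module.End k P)
    (hτ : ∀ c a p, τ c (σ a p) = σ a (τ c p)) : C →ₙₐ[k] Module.End k (BalancedTensor σ ρ) where
  toFun c := map id (τ c) LinearMap.id (fun a => hτ c (MulOpposite.op a)) fun _ _ => rfl
  map_smul' r c := (generates_mk σ ρ).ext fun p q => by simp
  map_zero' := (generates_mk σ ρ).ext fun p q => by simp
  map_add' c d := (generates_mk σ ρ).ext fun p q => by simp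
  map_mul' c d := (generates_mk σ ρ).ext fun p q => by simp

@[simp]
theorem leftAction_mk (τ : C →ₙₐ[k] Module.End k P) (hτ : ∀ c a p, τ c (σ a p) = σ a (τ c p))
    (c : C) (p : P) (q : Q) : leftAction σ ρ τ hτ c (mk σ ρ p q) = mk σ ρ (τ c p) q := rfl

/-- The action of `C` on `P ⊗_A Q` through an action on `Q` by `A`-linear maps. -/
def rightAction (τ : C →ₙₐ[k] Module.End k Q)
    (hτ : ∀ a c q, ρ a (τ c q) = τ c (ρ a q)) : C →ₙₐ[k] Module.End k (BalancedTensor σ ρ) where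
  toFun c := map id LinearMap.id (τ c) (fun _ _ => rfl) fun a q => (hτ a c q).symm
  map_smul' r c := (generates_mk σ ρ).ext fun p q => by simp
  map_zero' := (generates_mk σ ρ).ext fun p q => by simp
  map_add' c d := (generates_mk σ ρ).ext fun p q => by simp
  map_mul' c d := (generates_mk σ ρ).ext fun p q => by simp

@[simp]
theorem rightAction_mk (τ : C →ₙₐ[k] Module.End k Q) (hτ : ∀ a c q, ρ a (τ c q) = τ c (ρ a q))
    (c : C) (p : P) (q : Q) : rightAction σ ρ τ hτ c (mk σ ρ p q) = mk σ ρ p (τ c q) := rfl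

end Action

end BalancedTensor

/-! ### Firm modules -/

section Firm

variable {k A : Type u} [CommRing k] [NonUnitalRing A] [Module k A]
  {M : Type u} [AddCommGroup M] [Module k M]

/-- The values `a m` span `M`, that is, `A M = M`. -/
abbrev ActionGenerates (ρ : A →ₙₐ[k] Module.End k M) : Prop :=
  Generates (ρ : A →ₗ[k] Module.End k M)

@[elab_as_elim]
theorem ActionGenerates.induction {ρ : A →ₙₐ[k] Module.End k M} (hρ : ActionGenerates ρ)
    {motive : M → Prop} (apply : ∀ a m, motive (ρ a m))
    (add : ∀ m m', motive m → motive m' → motive (m + m')) (m : M) : motive m :=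
  Generates.induction hρ apply add m

/-- The module `M` has the universal property of `A ⊗_A M`. Right modules are left modules over
`Aᵐᵒᵖ`, so the notion covers unital modules on either side. -/
structure IsFirm (ρ : A →ₙₐ[k] Module.End k M) : Prop where
  generates : ActionGenerates ρ
  exists_lift : ∀ {R : Type u} [AddCommGroup R] [Module k R] (φ : A →ₗ[k] M →ₗ[k] R),
    (∀ a b m, φ (a * b) m = φ a (ρ b m)) → ∃ s : M →ₗ[k] R, ∀ a m, s (ρ a m) = φ a m

theorem isFirm_iff_bijective_of_universal {ρ : A →ₙₐ[k] Module.End k M} {X : Type u}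
    [AddCommGroup X] [Module k X] {β : A →ₗ[k] M →ₗ[k] X} (hβ : Generates β)
    (hbal : ∀ a b m, β (a * b) m = β a (ρ b m))
    (hlift : ∀ {R : Type u} [AddCommGroup R] [Module k R] (φ : A →ₗ[k] M →ₗ[k] R),
      (∀ a b m, φ (a * b) m = φ a (ρ b m)) → ∃ s : X →ₗ[k] R, ∀ a m, s (β a m) = φ a m)
    {f : X →ₗ[k] M} (hf : ∀ a m, f (β a m) = ρ a m) : IsFirm ρ ↔ Function.Bijective f := by
  refine ⟨fun h => ⟨?_, h.generates.surjective fun a m => ⟨β a m, hf a m⟩⟩, fun h => ⟨?_, ?_⟩⟩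
  · obtain ⟨s, hs⟩ := h.exists_lift β hbal
    have hsf : s ∘ₗ f = LinearMap.id :=
      hβ.ext fun a m => (congrArg s (hf a m)).trans (hs a m)
    exact Function.LeftInverse.injective (LinearMap.congr_fun hsf)
  · intro S hS m
    obtain ⟨x, rfl⟩ := h.2 m
    exact hβ (S.comap f) (fun a m => by simpa [hf] using hS a m) x
  · intro R _ _ φ hφ
    obtain ⟨s, hs⟩ := hlift φ hφ
    let e := LinearEquiv.ofBijective f h
    refine ⟨s ∘ₗ e.symm, fun a m => ?_⟩
    have : e.symm (ρ a m) = β a m := e.symm_apply_eq.2 (hf a m).symm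
    simp [this, hs]

variable [IsScalarTower k A A] [SMulCommClass k A A]

theorem isFirm_iff_isUnitalLeft {ρ : A →ₙₐ[k] Module.End k M} : IsFirm ρ ↔ IsUnitalLeft ρ :=
  isFirm_iff_bijective_of_universal (BalancedTensor.generates_mk (rightRegular k A) ρ)
    (fun a b => BalancedTensor.mk_balanced (rightRegular k A) ρ b a)
    (fun φ hφ => ⟨balancedLift (rightRegular k A) ρ φ fun a b => hφ b a, fun _ _ => rfl⟩)
    fun _ _ => rfl

theorem isFirm_iff_isUnitalRight {σ : Aᵐᵒᵖ →ₙₐ[k] Module.End k M} :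
    IsFirm σ ↔ IsUnitalRight σ := by
  let o : A ≃ₗ[k] Aᵐᵒᵖ := MulOpposite.opLinearEquiv k
  let mk := BalancedTensor.mk σ (NonUnitalAlgHom.lmul k A)
  refine isFirm_iff_bijective_of_universal (β := mk.flip ∘ₗ o.symm.toLinearMap)
    (fun S hS => BalancedTensor.generates_mk _ _ S fun m a => hS (o a) m)
    (fun a b m => (BalancedTensor.mk_balanced σ (NonUnitalAlgHom.lmul k A) b.unop m a.unop).symm)
    (fun φ hφ => ?_) fun _ _ => rfl
  exact ⟨balancedLift σ (NonUnitalAlgHom.lmul k A) (φ ∘ₗ o.toLinearMap).flip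
    fun a m b => (hφ (o b) (o a) m).symm, fun _ _ => rfl⟩

theorem injective_of_kernel_annihilated (hA : IsFirm (NonUnitalAlgHom.lmul k A))
    {ρ : A →ₙₐ[k] Module.End k M} (hρ : ActionGenerates ρ) (f : M →ₗ[k] A)
    (hf : ∀ a m, f (ρ a m) = a * f m) (hsurj : Function.Surjective f)
    (hker : ∀ m, f m = 0 → ∀ a, ρ a m = 0) : Function.Injective f := by
  have hfiber : ∀ a m n, f m = f n → ρ a m = ρ a n := fun a m n h => by
    rw [← sub_eq_zero, ← map_sub]
    exact hker _ (by simp [h]) a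
  choose g hg using hsurj
  -- `a ⊗ b ↦ a • g b` does not depend on the set-theoretic section `g` of `f`.
  let φ : A →ₗ[k] A →ₗ[k] M := LinearMap.mk₂ k (fun a b => ρ a (g b))
    (fun a b c => by simp) (fun c a b => by simp)
    (fun a b c => by rw [← map_add]; exact hfiber a _ _ (by simp [hg]))
    (fun c a b => by rw [← map_smul]; exact hfiber a _ _ (by simp [hg]))
  obtain ⟨s, hs⟩ := hA.exists_lift φ fun a b c => by
    simp only [φ, LinearMap.mk₂_apply, map_mul, Module.End.mul_apply]
    exact hfiber a _ _ (by simp [hf, hg])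
  have hsf : s ∘ₗ f = LinearMap.id := hρ.ext fun a m => calc
    s (f (ρ a m)) = s (a * f m) := by rw [hf]
    _ = ρ a (g (f m)) := hs a (f m)
    _ = ρ a m := hfiber a _ _ (hg _)
  exact Function.LeftInverse.injective (LinearMap.congr_fun hsf)

end Firm

/-! ### Actions of tensor products -/

section TensorActions

variable {k A : Type u} [CommRing k] [NonUnitalRing A] [Module k A]
  {M N : Type u} [AddCommGroup M] [Module k M] [AddCommGroup N] [Module k N]

theorem IsFirm.congr {ρ : A →ₙₐ[k] Module.End k M} (hρ : IsFirm ρ) {τ : A →ₙₐ[k] Module.End k N}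
    (e : M ≃ₗ[k] N) (he : ∀ a m, e (ρ a m) = τ a (e m)) : IsFirm τ where
  generates S hS n := by
    have := hρ.generates (S.comap e.toLinearMap) (fun a m => by simpa [he] using hS a (e m))
    simpa using this (e.symm n)
  exists_lift φ hφ := by
    obtain ⟨s, hs⟩ := hρ.exists_lift (φ.compl₂ e.toLinearMap) fun a b m => by simp [hφ, he]
    refine ⟨s ∘ₗ e.symm.toLinearMap, fun a n => ?_⟩
    obtain ⟨m, rfl⟩ := e.surjective n
    simp [← he, hs]

theorem map_mul_of_generates {B : Type*} [NonUnitalRing B] [Module k B] {β : M →ₗ[k] N →ₗ[k] A}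
    (hβ : Generates β) {f : A →ₗ[k] B}
    (hf : ∀ m n m' n', f (β m n * β m' n') = f (β m n) * f (β m' n')) (x y : A) :
    f (x * y) = f x * f y := by
  induction x using hβ.induction with
  | add x x' hx hx' => simp only [add_mul, map_add, hx, hx']
  | apply m n =>
    induction y using hβ.induction with
    | add y y' hy hy' => simp only [mul_add, map_add, hy, hy']
    | apply m' n' => exact hf m n m' n'

/-- The left `A`-module `N ⊗ M`, for a left `A`-module `M` and a `k`-module `N`. -/
noncomputable def lTensorAction (N : Type*) [AddCommGroup N] [Module k N]
    (ρ : A →ₙₐ[k] Module.End k M) : A →ₙₐ[k] Module.End k (N ⊗[k] M) where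
  toFun a := (ρ a).lTensor N
  map_smul' c a := by simp [LinearMap.lTensor_smul]
  map_zero' := by simp
  map_add' a b := by simp [LinearMap.lTensor_add]
  map_mul' a b := by simp [LinearMap.lTensor_mul]

@[simp]
theorem lTensorAction_tmul (ρ : A →ₙₐ[k] Module.End k M) (a : A) (n : N) (m : M) :
    lTensorAction N ρ a (n ⊗ₜ[k] m) = n ⊗ₜ[k] ρ a m := rfl

theorem IsFirm.tensorAction {ρ : A →ₙₐ[k] Module.End k M} (hρ : IsFirm ρ) (N : Type u)
    [AddCommGroup N] [Module k N] : IsFirm (tensorAction ρ N) where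
  generates S hS := generates_mk S fun m n =>
    hρ.generates (S.comap ((TensorProduct.mk k M N).flip n)) (fun a m => hS a (m ⊗ₜ[k] n)) m
  exists_lift {R} _ _ φ hφ := by
    obtain ⟨s, hs⟩ := hρ.exists_lift ((TensorProduct.lcurry (.id k) M N R) ∘ₗ φ)
      fun a b m => LinearMap.ext fun n => hφ a b (m ⊗ₜ n)
    refine ⟨TensorProduct.lift s, fun a x => ?_⟩
    induction x with
    | zero => simp only [map_zero]
    | add x y hx hy => simp only [map_add, hx, hy]
    | tmul m n => exact LinearMap.congr_fun (hs a m) n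

theorem IsFirm.lTensorAction {ρ : A →ₙₐ[k] Module.End k M} (hρ : IsFirm ρ) (N : Type u)
    [AddCommGroup N] [Module k N] : IsFirm (lTensorAction N ρ) :=
  (hρ.tensorAction N).congr (TensorProduct.comm k M N) fun a x => by
    induction x with
    | zero => simp only [map_zero]
    | add x y hx hy => simp only [map_add, hx, hy]
    | tmul m n => rfl

theorem tensorAction_lTensorAction_comm {B : Type u} [NonUnitalRing B] [Module k B]
    (ρ : A →ₙₐ[k] Module.End k M) (τ : B →ₙₐ[k] Module.End k N) (a : A) (b : B) (x : M ⊗[k] N) :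
    tensorAction ρ N a (lTensorAction M τ b x) = lTensorAction M τ b (tensorAction ρ N a x) :=
  LinearMap.congr_fun ((LinearMap.rTensor_comp_lTensor M (ρ a) (τ b)).trans
    (LinearMap.lTensor_comp_rTensor M (ρ a) (τ b)).symm) x

end TensorActions

section CommutingActions

variable {k A B : Type u} [CommRing k]
  [NonUnitalRing A] [Module k A] [IsScalarTower k A A] [SMulCommClass k A A]
  [NonUnitalRing B] [Module k B] [IsScalarTower k B B] [SMulCommClass k B B]
  {M : Type u} [AddCommGroup M] [Module k M]

/-- The action of `A ⊗ B` given by commuting actions of `A` and `B`. -/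
noncomputable def commAction (ρ : A →ₙₐ[k] Module.End k M) (σ : B →ₙₐ[k] Module.End k M)
    (hc : ∀ a b m, ρ a (σ b m) = σ b (ρ a m)) : A ⊗[k] B →ₙₐ[k] Module.End k M :=
  let f : A ⊗[k] B →ₗ[k] Module.End k M := TensorProduct.lift
    ((LinearMap.mul k (Module.End k M)).compl₁₂ (ρ : A →ₗ[k] Module.End k M)
      (σ : B →ₗ[k] Module.End k M))
  { f with
    map_zero' := map_zero f
    map_mul' := fun x y => by
      change f (x * y) = f x * f y
      induction x with
      | zero => simp only [zero_mul, map_zero]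
      | add x x' hx hx' => simp only [add_mul, map_add, hx, hx']
      | tmul a b =>
        induction y with
        | zero => simp only [mul_zero, map_zero]
        | add y y' hy hy' => simp only [mul_add, map_add, hy, hy']
        | tmul a' b' => ext m; simp [f, hc] }

@[simp]
theorem commAction_tmul {ρ : A →ₙₐ[k] Module.End k M} {σ : B →ₙₐ[k] Module.End k M}
    (hc : ∀ a b m, ρ a (σ b m) = σ b (ρ a m)) (a : A) (b : B) (m : M) :
    commAction ρ σ hc (a ⊗ₜ[k] b) m = ρ a (σ b m) := rfl

theorem lmul_rightRegular_comm (a : A) (b : Aᵐᵒᵖ) (x : A) :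
    NonUnitalAlgHom.lmul k A a (rightRegular k A b x) =
      rightRegular k A b (NonUnitalAlgHom.lmul k A a x) :=
  (mul_assoc a x b.unop).symm

theorem envAction_eq_commAction : envAction k A =
    commAction (NonUnitalAlgHom.lmul k A) (rightRegular k A) lmul_rightRegular_comm := by
  ext x : 1
  induction x with
  | zero => simp only [map_zero]
  | add x y hx hy => simp only [map_add, hx, hy]
  | tmul a b => rfl

theorem ActionGenerates.commAction {ρ : A →ₙₐ[k] Module.End k M}
    {σ : B →ₙₐ[k] Module.End k M} (hρ : ActionGenerates ρ) (hσ : ActionGenerates σ)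
    (hc : ∀ a b m, ρ a (σ b m) = σ b (ρ a m)) : ActionGenerates (commAction ρ σ hc) :=
  fun S hS => hρ S fun a => hσ (S.comap (ρ a)) fun b m => hS (a ⊗ₜ[k] b) m

theorem lmul_tensor_generates (hA : ActionGenerates (NonUnitalAlgHom.lmul k A))
    (hB : ActionGenerates (NonUnitalAlgHom.lmul k B)) :
    ActionGenerates (NonUnitalAlgHom.lmul k (A ⊗[k] B)) := fun S hS x => by
  induction x with
  | zero => exact S.zero_mem
  | add x y hx hy => exact S.add_mem hx hy
  | tmul a b =>
    induction a using hA.induction with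
    | add a a' h h' => rw [TensorProduct.add_tmul]; exact S.add_mem h h'
    | apply a a' =>
      induction b using hB.induction with
      | add b b' h h' => rw [TensorProduct.tmul_add]; exact S.add_mem h h'
      | apply b b' => simpa using hS (a ⊗ₜ b) (a' ⊗ₜ b')

theorem apply_multiplier {τ : A →ₙₐ[k] Module.End k M} {R : Type*} [AddCommGroup R] [Module k R]
    (hA : ActionGenerates (NonUnitalAlgHom.lmul k A)) {φ : A →ₗ[k] M →ₗ[k] R}
    (hφ : ∀ x y m, φ (x * y) m = φ x (τ y m)) {T : A →ₗ[k] A} (hT : ∀ x y, T (x * y) = x * T y)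
    {t : Module.End k M} (ht : ∀ x m, τ (T x) m = τ x (t m)) (x : A) (m : M) :
    φ (T x) m = φ x (t m) := by
  refine LinearMap.congr_fun (f := φ.flip m ∘ₗ T) (g := φ.flip (t m)) (hA.ext fun x y => ?_) x
  calc φ (T (x * y)) m = φ x (τ (T y) m) := by rw [hT, hφ]
    _ = φ (x * y) (t m) := by rw [ht, hφ]

theorem map_multiplier {S : A →ₗ[k] A} {T : B →ₗ[k] B} (hS : ∀ a a', S (a * a') = a * S a')
    (hT : ∀ b b', T (b * b') = b * T b') (x y : A ⊗[k] B) :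
    TensorProduct.map S T (x * y) = x * TensorProduct.map S T y := by
  induction x with
  | zero => simp only [zero_mul, map_zero]
  | add x x' hx hx' => simp only [add_mul, map_add, hx, hx']
  | tmul a b =>
    induction y with
    | zero => simp only [mul_zero, map_zero]
    | add y y' hy hy' => simp only [mul_add, map_add, hy, hy']
    | tmul a' b' => simp [hS, hT]

theorem IsFirm.commAction (hA : ActionGenerates (NonUnitalAlgHom.lmul k A))
    (hB : ActionGenerates (NonUnitalAlgHom.lmul k B))
    {ρ : A →ₙₐ[k] Module.End k M} {σ : B →ₙₐ[k] Module.End k M} (hρ : IsFirm ρ) (hσ : IsFirm σ)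
    (hc : ∀ a b m, ρ a (σ b m) = σ b (ρ a m)) : IsFirm (commAction ρ σ hc) where
  generates := hρ.generates.commAction hσ.generates hc
  exists_lift {R} _ _ φ hφ := by
    have hAB := lmul_tensor_generates hA hB
    have hφA : ∀ c a b m, φ ((a * c) ⊗ₜ b) m = φ (a ⊗ₜ b) (ρ c m) := fun c a b =>
      apply_multiplier hAB hφ (T := (LinearMap.mulRight k c).rTensor B)
        (map_multiplier (fun a a' => mul_assoc a a' c) fun _ _ => rfl) (fun x m => by
        induction x with
        | zero => simp only [map_zero, LinearMap.zero_apply]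
        | add x y hx hy => simp only [map_add, LinearMap.add_apply, hx, hy]
        | tmul a b => simp [← hc]) (a ⊗ₜ b)
    have hφB : ∀ c a b m, φ (a ⊗ₜ (b * c)) m = φ (a ⊗ₜ b) (σ c m) := fun c a b =>
      apply_multiplier hAB hφ (T := (LinearMap.mulRight k c).lTensor A)
        (map_multiplier (fun _ _ => rfl) fun b b' => mul_assoc b b' c) (fun x m => by
        induction x with
        | zero => simp only [map_zero, LinearMap.zero_apply]
        | add x y hx hy => simp only [map_add, LinearMap.add_apply, hx, hy]
        | tmul a b => simp) (a ⊗ₜ b)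
    let ψ : A →ₗ[k] M →ₗ[k] B →ₗ[k] R :=
      (LinearMap.lflip (R₀ := k)).toLinearMap ∘ₗ (TensorProduct.mk k A B).compr₂ φ
    obtain ⟨s, hs⟩ := hρ.exists_lift ψ fun a c m => LinearMap.ext fun b => hφA c a b m
    have hs' : ∀ a m b, s (ρ a m) b = φ (a ⊗ₜ b) m := fun a m b => LinearMap.congr_fun (hs a m) b
    obtain ⟨t, ht⟩ := hσ.exists_lift s.flip fun b c m => by
      induction m using hρ.generates.induction with
      | apply a m =>
        rw [LinearMap.flip_apply, LinearMap.flip_apply, ← hc, hs', hs', hφB]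
      | add m m' hm hm' => simp only [map_add, hm, hm']
    refine ⟨t, fun x m => ?_⟩
    induction x with
    | zero => simp only [map_zero, LinearMap.zero_apply]
    | add x y hx hy => simp only [map_add, LinearMap.add_apply, hx, hy]
    | tmul a b => rw [commAction_tmul, hc, ht]; exact hs' a m b

end CommutingActions

section CommutingEquivariant

variable {k A B : Type u} [CommRing k]
  [NonUnitalRing A] [Module k A] [IsScalarTower k A A] [SMulCommClass k A A]
  [NonUnitalRing B] [Module k B] [IsScalarTower k B B] [SMulCommClass k B B]
  {M N : Type u} [AddCommGroup M] [Module k M] [AddCommGroup N] [Module k N]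
  {ρ : A →ₙₐ[k] Module.End k M} {σ : B →ₙₐ[k] Module.End k M}
  {ρ' : A →ₙₐ[k] Module.End k N} {σ' : B →ₙₐ[k] Module.End k N}
  {hc : ∀ a b m, ρ a (σ b m) = σ b (ρ a m)} {hc' : ∀ a b n, ρ' a (σ' b n) = σ' b (ρ' a n)}
  {f : M →ₗ[k] N}

theorem map_commAction {φ : A →ₗ[k] A} {ψ : B →ₗ[k] B} (hρ : ∀ a m, f (ρ a m) = ρ' (φ a) (f m))
    (hσ : ∀ b m, f (σ b m) = σ' (ψ b) (f m)) (z : A ⊗[k] B) (m : M) :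
    f (commAction ρ σ hc z m) = commAction ρ' σ' hc' (TensorProduct.map φ ψ z) (f m) := by
  induction z with
  | zero => simp only [map_zero, LinearMap.zero_apply]
  | add z w hz hw => simp only [map_add, LinearMap.add_apply, hz, hw]
  | tmul a b => simp only [commAction_tmul, TensorProduct.map_tmul, hρ, hσ]

theorem map_left_of_map_commAction (hρ : ActionGenerates ρ) (hσ : ActionGenerates σ)
    (hf : ∀ z m, f (commAction ρ σ hc z m) = commAction ρ' σ' hc' z (f m)) (a : A) (m : M) :
    f (ρ a m) = ρ' a (f m) := by
  induction m using hρ.induction with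
  | add m n hm hn => simp only [map_add, hm, hn]
  | apply d m =>
    induction m using hσ.induction with
    | add m n hm hn => simp only [map_add, hm, hn]
    | apply b m =>
      calc f (ρ a (ρ d (σ b m)))
        _ = f (commAction ρ σ hc ((a * d) ⊗ₜ b) m) := by rw [commAction_tmul, map_mul]; rfl
        _ = ρ' (a * d) (σ' b (f m)) := hf _ _
        _ = ρ' a (commAction ρ' σ' hc' (d ⊗ₜ b) (f m)) := by rw [commAction_tmul, map_mul]; rfl
        _ = ρ' a (f (ρ d (σ b m))) := congrArg (ρ' a) (hf _ _).symm

theorem map_right_of_map_commAction (hρ : ActionGenerates ρ) (hσ : ActionGenerates σ)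
    (hf : ∀ z m, f (commAction ρ σ hc z m) = commAction ρ' σ' hc' z (f m)) (b : B) (m : M) :
    f (σ b m) = σ' b (f m) := by
  induction m using hρ.induction with
  | add m n hm hn => simp only [map_add, hm, hn]
  | apply a m =>
    induction m using hσ.induction with
    | add m n hm hn => simp only [map_add, hm, hn]
    | apply d m =>
      calc f (σ b (ρ a (σ d m)))
        _ = f (commAction ρ σ hc (a ⊗ₜ (b * d)) m) := by
          rw [← hc, commAction_tmul, map_mul]; rfl
        _ = ρ' a (σ' (b * d) (f m)) := hf _ _
        _ = σ' b (commAction ρ' σ' hc' (a ⊗ₜ d) (f m)) := by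
          rw [commAction_tmul, ← hc', map_mul]; rfl
        _ = σ' b (f (ρ a (σ d m))) := congrArg (σ' b) (hf _ _).symm

end CommutingEquivariant

/-! ### Bimodules and pairings -/

section LeftAction

variable {k A C : Type u} [CommRing k] [NonUnitalRing A] [Module k A] [NonUnitalRing C]
  [Module k C] {P Q : Type u} [AddCommGroup P] [Module k P] [AddCommGroup Q] [Module k Q]
  {σ : Aᵐᵒᵖ →ₙₐ[k] Module.End k P} (ρ : A →ₙₐ[k] Module.End k Q)
  {τ : C →ₙₐ[k] Module.End k P}

theorem ActionGenerates.leftAction (hτ : ActionGenerates τ)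
    (hc : ∀ c a p, τ c (σ a p) = σ a (τ c p)) :
    ActionGenerates (BalancedTensor.leftAction σ ρ τ hc) := fun S hS =>
  BalancedTensor.generates_mk σ ρ S fun p q =>
    hτ (S.comap ((BalancedTensor.mk σ ρ).flip q)) (fun c p => hS c (BalancedTensor.mk σ ρ p q)) p

theorem IsFirm.leftAction (hτ : IsFirm τ) (hc : ∀ c a p, τ c (σ a p) = σ a (τ c p)) :
    IsFirm (BalancedTensor.leftAction σ ρ τ hc) where
  generates := hτ.generates.leftAction ρ hc
  exists_lift {R} _ _ φ hφ := by
    let ψ : C →ₗ[k] P →ₗ[k] Q →ₗ[k] R := LinearMap.mk₂ k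
      (fun c p => φ c ∘ₗ BalancedTensor.mk σ ρ p)
      (fun c d p => by ext q; simp) (fun r c p => by ext q; simp)
      (fun c p p' => by ext q; simp) (fun r c p => by ext q; simp)
    obtain ⟨s, hs⟩ := hτ.exists_lift ψ fun c d p => LinearMap.ext fun q =>
      hφ c d (BalancedTensor.mk σ ρ p q)
    have hbal : ∀ a p q, s (σ (MulOpposite.op a) p) q = s p (ρ a q) := fun a p q => by
      induction p using hτ.generates.induction with
      | apply c p =>
        rw [← hc, hs, hs]
        exact congrArg (φ c) (BalancedTensor.mk_balanced σ ρ a p q)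
      | add p p' hp hp' => simp only [map_add, LinearMap.add_apply, hp, hp']
    refine ⟨balancedLift σ ρ s hbal, fun c x => ?_⟩
    induction x with
    | mk p q => exact LinearMap.congr_fun (hs c p) q
    | add x y hx hy => simp only [map_add, hx, hy]

end LeftAction

section Prebimodule

variable {k : Type u} [CommRing k] {G : Type v} [Group G]

/-- An `A`-`B`-bimodule with a compatible action of `G`, not necessarily unital. -/
structure GPrebimodule {A B : Type u} [NonUnitalRing A] [Module k A] [NonUnitalRing B] [Module k B]
    (α : AlgAction k G A) (β : AlgAction k G B) where
  carrier : Type u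
  [addCommGroup : AddCommGroup carrier]
  [module : Module k carrier]
  left : A →ₙₐ[k] Module.End k carrier
  right : Bᵐᵒᵖ →ₙₐ[k] Module.End k carrier
  comm : ∀ (a : A) (b : Bᵐᵒᵖ) (p : carrier), left a (right b p) = right b (left a p)
  rep : Representation k G carrier
  rep_left : ∀ (g : G) (a : A) (p : carrier), rep g (left a p) = left (α.rep g a) (rep g p)
  rep_right : ∀ (g : G) (b : B) (p : carrier),
    rep g (right (MulOpposite.op b) p) = right (MulOpposite.op (β.rep g b)) (rep g p)

attribute [instance] GPrebimodule.addCommGroup GPrebimodule.module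

namespace GPrebimodule

section Tensor

variable {A B C : Type u} [NonUnitalRing A] [Module k A] [NonUnitalRing B] [Module k B]
  [NonUnitalRing C] [Module k C]
  {α : AlgAction k G A} {β : AlgAction k G B} {γ : AlgAction k G C}

/-- The bimodule `P ⊗_C Q`. -/
def tensor (P : GPrebimodule α γ) (Q : GPrebimodule γ β) : GPrebimodule α β where
  carrier := BalancedTensor P.right Q.left
  left := BalancedTensor.leftAction P.right Q.left P.left fun a c p => P.comm a c p
  right := BalancedTensor.rightAction P.right Q.left Q.right Q.comm
  comm a b x := by
    induction x with
    | mk p q => rfl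
    | add x y hx hy => simp only [map_add, hx, hy]
  rep :=
    { toFun := fun g =>
        BalancedTensor.map (γ.rep g) (P.rep g) (Q.rep g) (P.rep_right g) (Q.rep_left g)
      map_one' := (BalancedTensor.generates_mk _ _).ext fun p q => by simp
      map_mul' := fun g h => (BalancedTensor.generates_mk _ _).ext fun p q => by simp }
  rep_left g a x := by
    induction x with
    | mk p q => simp [P.rep_left]
    | add x y hx hy => simp only [map_add, hx, hy]
  rep_right g b x := by
    induction x with
    | mk p q => simp [Q.rep_right]
    | add x y hx hy => simp only [map_add, hx, hy]

/-- The class of `p ⊗ q` in `P ⊗_C Q`. -/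
def tmul (P : GPrebimodule α γ) (Q : GPrebimodule γ β) :
    P.carrier →ₗ[k] Q.carrier →ₗ[k] (P.tensor Q).carrier :=
  BalancedTensor.mk P.right Q.left

@[elab_as_elim]
theorem tensor_induction {P : GPrebimodule α γ} {Q : GPrebimodule γ β}
    {motive : (P.tensor Q).carrier → Prop}
    (mk : ∀ p q, motive (P.tmul Q p q))
    (add : ∀ x y, motive x → motive y → motive (x + y)) (x : (P.tensor Q).carrier) : motive x :=
  BalancedTensor.induction_on mk add x

theorem tensor_left_generates {P : GPrebimodule α γ} (hP : ActionGenerates P.left)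
    (Q : GPrebimodule γ β) : ActionGenerates (P.tensor Q).left :=
  hP.leftAction Q.left fun a c p => P.comm a c p

theorem isFirm_tensor_left {P : GPrebimodule α γ} (hP : IsFirm P.left) (Q : GPrebimodule γ β) :
    IsFirm (P.tensor Q).left :=
  hP.leftAction Q.left fun a c p => P.comm a c p

end Tensor

section Unital

variable {A B : Type u}
  [NonUnitalRing A] [Module k A] [IsScalarTower k A A] [SMulCommClass k A A]
  [NonUnitalRing B] [Module k B] [IsScalarTower k B B] [SMulCommClass k B B]
  {α : AlgAction k G A} {β : AlgAction k G B}

/-- A bimodule that is unital on both sides, as a `GBimodule`. -/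
def toGBimodule (P : GPrebimodule α β) (hl : IsFirm P.left) (hr : IsFirm P.right) :
    GBimodule α β :=
  { P with
    unital_left := isFirm_iff_isUnitalLeft.1 hl
    unital_right := isFirm_iff_isUnitalRight.1 hr }

end Unital

end GPrebimodule

end Prebimodule

section Lift₂

variable {k A B : Type*} [CommRing k] [NonUnitalRing A] [Module k A] [NonUnitalRing B] [Module k B]
  {P Q P' Q' R : Type*} [AddCommGroup P] [Module k P] [AddCommGroup Q] [Module k Q]
  [AddCommGroup P'] [Module k P'] [AddCommGroup Q'] [Module k Q'] [AddCommGroup R] [Module k R]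
  {σ : Aᵐᵒᵖ →ₙₐ[k] Module.End k P} {ρ : A →ₙₐ[k] Module.End k Q}
  {σ' : Bᵐᵒᵖ →ₙₐ[k] Module.End k P'} {ρ' : B →ₙₐ[k] Module.End k Q'}

/-- The bilinear map on `(P ⊗_A Q) × (P' ⊗_B Q')` induced by a balanced quadrilinear map. -/
def BalancedTensor.lift₂ (t : P →ₗ[k] Q →ₗ[k] P' →ₗ[k] Q' →ₗ[k] R)
    (ht : ∀ (a : A) p q, t (σ (MulOpposite.op a) p) q = t p (ρ a q))
    (ht' : ∀ (b : B) p q p' q', t p q (σ' (MulOpposite.op b) p') q' = t p q p' (ρ' b q')) :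
    BalancedTensor σ ρ →ₗ[k] BalancedTensor σ' ρ' →ₗ[k] R :=
  balancedLift σ ρ
    (LinearMap.mk₂ k (fun p q => balancedLift σ' ρ' (t p q) fun b => ht' b p q)
      (fun _ _ _ => (generates_mk _ _).ext fun _ _ => by simp)
      (fun _ _ _ => (generates_mk _ _).ext fun _ _ => by simp)
      (fun _ _ _ => (generates_mk _ _).ext fun _ _ => by simp)
      (fun _ _ _ => (generates_mk _ _).ext fun _ _ => by simp))
    fun a p q => (generates_mk _ _).ext fun p' q' => by simp [ht]

end Lift₂

section Pairing

variable {k : Type u} [CommRing k] {G : Type v} [Group G]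
  {A B C : Type u} [NonUnitalRing A] [Module k A] [NonUnitalRing B] [Module k B]
  [NonUnitalRing C] [Module k C]
  {α : AlgAction k G A} {β : AlgAction k G B} {γ : AlgAction k G C}

/-- An equivariant map of bimodules `P ⊗_B Q → A`, as a balanced bilinear map. -/
structure GPairing (P : GPrebimodule α β) (Q : GPrebimodule β α) where
  bilin : P.carrier →ₗ[k] Q.carrier →ₗ[k] A
  balanced : ∀ (b : B) (p : P.carrier) (q : Q.carrier),
    bilin (P.right (MulOpposite.op b) p) q = bilin p (Q.left b q)
  map_left : ∀ (a : A) (p : P.carrier) (q : Q.carrier), bilin (P.left a p) q = a * bilin p q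
  map_right : ∀ (a : A) (p : P.carrier) (q : Q.carrier),
    bilin p (Q.right (MulOpposite.op a) q) = bilin p q * a
  equivariant : ∀ (g : G) (p : P.carrier) (q : Q.carrier),
    bilin (P.rep g p) (Q.rep g q) = α.rep g (bilin p q)

namespace GPairing

/-- The associativity relation `f(p, q) p' = p h(q, p')` of a Morita context. -/
def Compatible {P : GPrebimodule α β} {Q : GPrebimodule β α} (f : GPairing P Q)
    (h : GPairing Q P) : Prop :=
  ∀ (p : P.carrier) (q : Q.carrier) (p' : P.carrier),
    P.left (f.bilin p q) p' = P.right (MulOpposite.op (h.bilin q p')) p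

section Comp

variable {P : GPrebimodule α γ} {Q : GPrebimodule γ α} {P' : GPrebimodule γ β}
  {Q' : GPrebimodule β γ} (f : GPairing P Q) (f' : GPairing P' Q')

/-- The map `(p, p', q', q) ↦ f(p f'(p', q'), q)`. -/
def compQuadrilinear :
    P.carrier →ₗ[k] P'.carrier →ₗ[k] Q'.carrier →ₗ[k] Q.carrier →ₗ[k] A :=
  LinearMap.mk₂ k (fun p p' => f.bilin ∘ₗ (P.right : Cᵐᵒᵖ →ₗ[k] Module.End k P.carrier).flip p ∘ₗ
      (MulOpposite.opLinearEquiv k).toLinearMap ∘ₗ f'.bilin p')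
    (fun _ _ _ => by ext; simp) (fun _ _ _ => by ext; simp)
    (fun _ _ _ => by ext; simp) (fun _ _ _ => by ext; simp)

@[simp]
theorem compQuadrilinear_apply (p : P.carrier) (p' : P'.carrier) (q' : Q'.carrier)
    (q : Q.carrier) : compQuadrilinear f f' p p' q' q =
      f.bilin (P.right (MulOpposite.op (f'.bilin p' q')) p) q := rfl

/-- The bilinear map `(p ⊗ p', q' ⊗ q) ↦ f(p f'(p', q'), q)`. -/
def compBilin : (P.tensor P').carrier →ₗ[k] (Q'.tensor Q).carrier →ₗ[k] A :=
  BalancedTensor.lift₂ (compQuadrilinear f f')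
    (fun c p p' => by ext; simp [f'.map_left])
    (fun c p p' q' q => by simp [f'.map_right, ← f.balanced])

/-- The composite of the bimodule maps `P' ⊗ Q' → C` and `P ⊗ Q → A`, as a bimodule map
`(P ⊗ P') ⊗ (Q' ⊗ Q) → A`. -/
def comp : GPairing (P.tensor P') (Q'.tensor Q) where
  bilin := compBilin f f'
  balanced b x y := by
    induction x using GPrebimodule.tensor_induction with
    | mk p p' =>
      induction y using GPrebimodule.tensor_induction with
      | mk q' q =>
        change f.bilin
            (P.right (MulOpposite.op (f'.bilin (P'.right (MulOpposite.op b) p') q')) p) q =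
          f.bilin (P.right (MulOpposite.op (f'.bilin p' (Q'.left b q'))) p) q
        rw [f'.balanced]
      | add y y' hy hy' => simp only [map_add, hy, hy']
    | add x x' hx hx' => simp only [map_add, LinearMap.add_apply, hx, hx']
  map_left a x y := by
    induction x using GPrebimodule.tensor_induction with
    | mk p p' =>
      induction y using GPrebimodule.tensor_induction with
      | mk q' q =>
        change f.bilin (P.right (MulOpposite.op (f'.bilin p' q')) (P.left a p)) q =
          a * f.bilin (P.right (MulOpposite.op (f'.bilin p' q')) p) q
        rw [← P.comm, f.map_left]
      | add y y' hy hy' => simp only [map_add, mul_add, hy, hy']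
    | add x x' hx hx' => simp only [map_add, LinearMap.add_apply, mul_add, hx, hx']
  map_right a x y := by
    induction x using GPrebimodule.tensor_induction with
    | mk p p' =>
      induction y using GPrebimodule.tensor_induction with
      | mk q' q => exact f.map_right a _ q
      | add y y' hy hy' => simp only [map_add, add_mul, hy, hy']
    | add x x' hx hx' => simp only [map_add, LinearMap.add_apply, add_mul, hx, hx']
  equivariant g x y := by
    induction x using GPrebimodule.tensor_induction with
    | mk p p' =>
      induction y using GPrebimodule.tensor_induction with
      | mk q' q =>
        change f.bilin (P.right (MulOpposite.op (f'.bilin (P'.rep g p') (Q'.rep g q')))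
            (P.rep g p)) (Q.rep g q) =
          α.rep g (f.bilin (P.right (MulOpposite.op (f'.bilin p' q')) p) q)
        rw [f'.equivariant, ← P.rep_right, f.equivariant]
      | add y y' hy hy' => simp only [map_add, hy, hy']
    | add x x' hx hx' => simp only [map_add, LinearMap.add_apply, hx, hx']

theorem comp_generates (hP : ActionGenerates P.right) (hf : Generates f.bilin)
    (hf' : Generates f'.bilin) : Generates (comp f f').bilin := fun S hS =>
  hf S fun p q => hP (S.comap (f.bilin.flip q)) (fun c p => by
    obtain ⟨c, rfl⟩ := MulOpposite.op_surjective c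
    change f.bilin (P.right (MulOpposite.op c) p) q ∈ S
    induction c using hf'.induction with
    | apply p' q' => exact hS (BalancedTensor.mk _ _ p p') (BalancedTensor.mk _ _ q' q)
    | add c c' hc hc' =>
      simpa only [MulOpposite.op_add, map_add, LinearMap.add_apply] using S.add_mem hc hc') p

theorem Compatible.comp {f : GPairing P Q} {h : GPairing Q P} {f' : GPairing P' Q'}
    {h' : GPairing Q' P'} (hfh : f.Compatible h) (hfh' : f'.Compatible h') :
    (f.comp f').Compatible (h'.comp h) := fun x y x' => by
  induction x using GPrebimodule.tensor_induction with
  | mk p p' =>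
    induction y using GPrebimodule.tensor_induction with
    | mk q' q =>
      induction x' using GPrebimodule.tensor_induction with
      | mk r r' =>
        change BalancedTensor.mk P.right P'.left
            (P.left (f.bilin (P.right (MulOpposite.op (f'.bilin p' q')) p) q) r) r' =
          BalancedTensor.mk P.right P'.left p (P'.right (MulOpposite.op
            (h'.bilin (Q'.right (MulOpposite.op (h.bilin q r)) q') r')) p')
        rw [hfh, BalancedTensor.mk_balanced, BalancedTensor.mk_balanced, h'.balanced, hfh']
      | add y y' hy hy' => simp only [map_add, MulOpposite.op_add, LinearMap.add_apply, hy, hy']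
    | add y y' hy hy' => simp only [map_add, MulOpposite.op_add, LinearMap.add_apply, hy, hy']
  | add x x' hx hx' => simp only [map_add, LinearMap.add_apply, hx, hx']

end Comp

end GPairing

end Pairing

/-! ### Morita contexts -/

section Morita

variable {k : Type u} [CommRing k] {G : Type v} [Group G]

/-- A `G`-equivariant Morita context between algebras that need not be unital: the bimodules are
generated by their actions and the pairings are onto, but nothing is required to be bijective. -/
structure GMoritaContext {A B : Type u} [NonUnitalRing A] [Module k A] [NonUnitalRing B]
    [Module k B] (α : AlgAction k G A) (β : AlgAction k G B) where
  P : GPrebimodule α β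
  Q : GPrebimodule β α
  f : GPairing P Q
  h : GPairing Q P
  assoc_P : f.Compatible h
  assoc_Q : h.Compatible f
  P_generates : ActionGenerates P.left
  Q_generates : ActionGenerates Q.left
  f_generates : Generates f.bilin
  h_generates : Generates h.bilin

variable {A B C : Type u} [NonUnitalRing A] [Module k A] [NonUnitalRing B] [Module k B]
  [NonUnitalRing C] [Module k C]
  {α : AlgAction k G A} {β : AlgAction k G B} {γ : AlgAction k G C}

namespace GMoritaContext

/-- The context with the roles of `A` and `B` exchanged. -/
def symm (c : GMoritaContext α β) : GMoritaContext β α where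
  P := c.Q
  Q := c.P
  f := c.h
  h := c.f
  assoc_P := c.assoc_Q
  assoc_Q := c.assoc_P
  P_generates := c.Q_generates
  Q_generates := c.P_generates
  f_generates := c.h_generates
  h_generates := c.f_generates

theorem P_generates_right (c : GMoritaContext α β) : ActionGenerates c.P.right := fun S hS =>
  c.P_generates S fun a p => by
    induction a using c.f_generates.induction with
    | apply p' q => exact c.assoc_P p' q p ▸ hS _ _
    | add a a' ha ha' => simpa only [map_add, LinearMap.add_apply] using S.add_mem ha ha'

theorem lmul_generates_right [IsScalarTower k B B] [SMulCommClass k B B]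
    (c : GMoritaContext α β) : ActionGenerates (NonUnitalAlgHom.lmul k B) := fun S hS =>
  c.h_generates S fun q p => c.Q_generates (S.comap (c.h.bilin.flip p)) (fun b q' => by
    change c.h.bilin (c.Q.left b q') p ∈ S
    exact c.h.map_left b q' p ▸ hS b (c.h.bilin q' p)) q

/-- The composite of two Morita contexts, with bimodules `P ⊗_C P'` and `Q' ⊗_C Q`. -/
def trans (c : GMoritaContext α γ) (d : GMoritaContext γ β) : GMoritaContext α β where
  P := c.P.tensor d.P
  Q := d.Q.tensor c.Q
  f := c.f.comp d.f
  h := d.h.comp c.h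
  assoc_P := c.assoc_P.comp d.assoc_P
  assoc_Q := d.assoc_Q.comp c.assoc_Q
  P_generates := GPrebimodule.tensor_left_generates c.P_generates d.P
  Q_generates := GPrebimodule.tensor_left_generates d.Q_generates c.Q
  f_generates := GPairing.comp_generates c.f d.f c.P_generates_right c.f_generates d.f_generates
  h_generates :=
    GPairing.comp_generates d.h c.h d.symm.P_generates_right d.h_generates c.h_generates

/-- The map `P ⊗_B Q → A`. -/
def fLift (c : GMoritaContext α β) : (c.P.tensor c.Q).carrier →ₗ[k] A :=
  balancedLift c.P.right c.Q.left c.f.bilin c.f.balanced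

theorem fLift_surjective (c : GMoritaContext α β) : Function.Surjective c.fLift :=
  c.f_generates.surjective fun p q => ⟨BalancedTensor.mk _ _ p q, rfl⟩

theorem leftAction_f_apply (c : GMoritaContext α β) (p : c.P.carrier) (q : c.Q.carrier)
    (x : (c.P.tensor c.Q).carrier) :
    (c.P.tensor c.Q).left (c.f.bilin p q) x =
      (c.P.tensor c.Q).right (MulOpposite.op (c.fLift x)) (c.P.tmul c.Q p q) := by
  induction x using GPrebimodule.tensor_induction with
  | mk p' q' =>
    change BalancedTensor.mk c.P.right c.Q.left (c.P.left (c.f.bilin p q) p') q' =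
      BalancedTensor.mk c.P.right c.Q.left p (c.Q.right (MulOpposite.op (c.f.bilin p' q')) q)
    rw [c.assoc_P, BalancedTensor.mk_balanced, c.assoc_Q]
  | add x y hx hy => simp only [MulOpposite.op_add, map_add, LinearMap.add_apply, hx, hy]

variable [IsScalarTower k A A] [SMulCommClass k A A]

theorem fLift_injective (c : GMoritaContext α β) (hA : IsFirm (NonUnitalAlgHom.lmul k A)) :
    Function.Injective c.fLift := by
  refine injective_of_kernel_annihilated hA (GPrebimodule.tensor_left_generates c.P_generates c.Q)
    c.fLift (fun a x => ?_) c.fLift_surjective fun x hx a => ?_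
  · induction x using GPrebimodule.tensor_induction with
    | mk p q => exact c.f.map_left a p q
    | add x y hx hy => simp only [map_add, mul_add, hx, hy]
  · induction a using c.f_generates.induction with
    | apply p q =>
      rw [c.leftAction_f_apply, hx, MulOpposite.op_zero, map_zero, LinearMap.zero_apply]
    | add a b ha hb => simp only [map_add, LinearMap.add_apply, ha, hb, add_zero]

theorem exists_factor_f (c : GMoritaContext α β) (hA : IsFirm (NonUnitalAlgHom.lmul k A))
    {R : Type*} [AddCommGroup R] [Module k R] (t : c.P.carrier →ₗ[k] c.Q.carrier →ₗ[k] R)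
    (ht : ∀ b p q, t (c.P.right (MulOpposite.op b) p) q = t p (c.Q.left b q)) :
    ∃ ψ : A →ₗ[k] R, ∀ p q, ψ (c.f.bilin p q) = t p q := by
  let e := LinearEquiv.ofBijective c.fLift ⟨c.fLift_injective hA, c.fLift_surjective⟩
  let l : (c.P.tensor c.Q).carrier →ₗ[k] R := balancedLift c.P.right c.Q.left t ht
  have he : ∀ p q, e.symm (c.f.bilin p q) = c.P.tmul c.Q p q := fun p q => e.symm_apply_eq.2 rfl
  exact ⟨l ∘ₗ e.symm.toLinearMap, fun p q => congrArg l (he p q)⟩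

theorem isFirm_right (c : GMoritaContext α β) (hA : IsFirm (NonUnitalAlgHom.lmul k A))
    (hP : IsFirm c.P.left) : IsFirm c.P.right where
  generates := c.P_generates_right
  exists_lift {R} _ _ φ hφ := by
    let t : c.P.carrier →ₗ[k] c.Q.carrier →ₗ[k] c.P.carrier →ₗ[k] R := LinearMap.mk₂ k
      (fun p q => φ.flip p ∘ₗ (MulOpposite.opLinearEquiv k).toLinearMap ∘ₗ c.h.bilin q)
      (fun _ _ _ => by ext; simp) (fun _ _ _ => by ext; simp)
      (fun _ _ _ => by ext; simp) (fun _ _ _ => by ext; simp)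
    have ht : ∀ p q p', t p q p' = φ (MulOpposite.op (c.h.bilin q p')) p := fun _ _ _ => rfl
    obtain ⟨ψ, hψ⟩ := c.exists_factor_f hA t fun b p q => LinearMap.ext fun p' => by
      rw [ht, ht, ← hφ, c.h.map_left, MulOpposite.op_mul]
    obtain ⟨s, hs⟩ := hP.exists_lift ψ fun a b p' => by
      induction a using c.f_generates.induction with
      | apply p q => rw [← c.f.map_right, hψ, hψ, ht, ht, c.h.balanced]
      | add a a' ha ha' => simp only [add_mul, map_add, LinearMap.add_apply, ha, ha']
    refine ⟨s, fun b p => ?_⟩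
    obtain ⟨b, rfl⟩ := MulOpposite.op_surjective b
    induction b using c.h_generates.induction with
    | apply q p' => rw [← c.assoc_P, hs, hψ, ht]
    | add b b' hb hb' =>
      simp only [MulOpposite.op_add, map_add, LinearMap.add_apply, hb, hb']

/-- Over unital algebras, a context whose bimodules are unital on the left is strict. -/
def toStrict [IsScalarTower k B B] [SMulCommClass k B B] (c : GMoritaContext α β)
    (hA : IsFirm (NonUnitalAlgHom.lmul k A)) (hB : IsFirm (NonUnitalAlgHom.lmul k B))
    (hP : IsFirm c.P.left) (hQ : IsFirm c.Q.left) : StrictGMoritaContext α β where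
  P := c.P.toGBimodule hP (c.isFirm_right hA hP)
  Q := c.Q.toGBimodule hQ (c.symm.isFirm_right hB hQ)
  f := c.fLift
  h := c.symm.fLift
  f_left := c.f.map_left
  f_right := c.f.map_right
  h_left := c.h.map_left
  h_right := c.h.map_right
  f_equivariant := c.f.equivariant
  h_equivariant := c.h.equivariant
  assoc_P := c.assoc_P
  assoc_Q := c.assoc_Q
  f_bijective := ⟨c.fLift_injective hA, c.fLift_surjective⟩
  h_bijective := ⟨c.symm.fLift_injective hB, c.symm.fLift_surjective⟩

end GMoritaContext

end Morita

/-! ### External tensor products -/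

section ExternalTensor

variable {k : Type u} [CommRing k]

section Actions

variable {A B : Type u}
  [NonUnitalRing A] [Module k A] [IsScalarTower k A A] [SMulCommClass k A A]
  [NonUnitalRing B] [Module k B] [IsScalarTower k B B] [SMulCommClass k B B]
  {M N : Type u} [AddCommGroup M] [Module k M] [AddCommGroup N] [Module k N]

/-- The action of `A ⊗ B` on `M ⊗ N`, for an `A`-module `M` and a `B`-module `N`. -/
noncomputable def externalAction (ρ : A →ₙₐ[k] Module.End k M) (τ : B →ₙₐ[k] Module.End k N) :
    A ⊗[k] B →ₙₐ[k] Module.End k (M ⊗[k] N) :=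
  commAction (tensorAction ρ N) (lTensorAction M τ) (tensorAction_lTensorAction_comm ρ τ)

@[simp]
theorem externalAction_tmul (ρ : A →ₙₐ[k] Module.End k M) (τ : B →ₙₐ[k] Module.End k N) (a : A)
    (b : B) (m : M) (n : N) : externalAction ρ τ (a ⊗ₜ b) (m ⊗ₜ n) = ρ a m ⊗ₜ τ b n := rfl

theorem ActionGenerates.externalAction {ρ : A →ₙₐ[k] Module.End k M}
    {τ : B →ₙₐ[k] Module.End k N} (hρ : ActionGenerates ρ) (hτ : ActionGenerates τ) :
    ActionGenerates (externalAction ρ τ) := fun S hS =>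
  generates_mk S fun m n => by
    induction m using hρ.induction with
    | apply a m =>
      exact hτ (S.comap (TensorProduct.mk k M N (ρ a m))) (fun b n => hS (a ⊗ₜ b) (m ⊗ₜ n)) n
    | add m m' hm hm' => simpa only [map_add, LinearMap.add_apply] using S.add_mem hm hm'

variable (k A B) in
/-- The canonical map `(A ⊗ B)ᵒᵖ → Aᵒᵖ ⊗ Bᵒᵖ`. -/
noncomputable def opTensor : (A ⊗[k] B)ᵐᵒᵖ →ₙₐ[k] Aᵐᵒᵖ ⊗[k] Bᵐᵒᵖ where
  toFun x := TensorProduct.map (MulOpposite.opLinearEquiv k).toLinearMap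
    (MulOpposite.opLinearEquiv k).toLinearMap x.unop
  map_smul' c x := by simp
  map_zero' := by simp
  map_add' x y := by simp
  map_mul' x y := by
    obtain ⟨x, rfl⟩ := MulOpposite.op_surjective x
    obtain ⟨y, rfl⟩ := MulOpposite.op_surjective y
    simp only [← MulOpposite.op_mul, MulOpposite.unop_op]
    induction x with
    | zero => simp only [mul_zero, map_zero, zero_mul]
    | add x x' hx hx' => simp only [mul_add, map_add, add_mul, hx, hx']
    | tmul a b =>
      induction y with
      | zero => simp only [mul_zero, map_zero, zero_mul]
      | add y y' hy hy' => simp only [mul_add, map_add, add_mul, hy, hy']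
      | tmul a' b' => simp

@[simp]
theorem opTensor_op_tmul (a : A) (b : B) :
    opTensor k A B (MulOpposite.op (a ⊗ₜ b)) = MulOpposite.op a ⊗ₜ MulOpposite.op b := rfl

end Actions

variable {G : Type v} [Group G] {A B A' B' : Type u}
  [NonUnitalRing A] [Module k A] [IsScalarTower k A A] [SMulCommClass k A A]
  [NonUnitalRing B] [Module k B] [IsScalarTower k B B] [SMulCommClass k B B]
  [NonUnitalRing A'] [Module k A'] [IsScalarTower k A' A'] [SMulCommClass k A' A']
  [NonUnitalRing B'] [Module k B'] [IsScalarTower k B' B'] [SMulCommClass k B' B']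
  {α : AlgAction k G A} {β : AlgAction k G B} {α' : AlgAction k G A'} {β' : AlgAction k G B'}

/-- The `A ⊗ A'`-`B ⊗ B'`-bimodule `P ⊗ P'`. -/
noncomputable def GPrebimodule.external (P : GPrebimodule α β) (P' : GPrebimodule α' β') :
    GPrebimodule (α.tensor α') (β.tensor β') where
  carrier := P.carrier ⊗[k] P'.carrier
  left := externalAction P.left P'.left
  right := (externalAction P.right P'.right).comp (opTensor k B B')
  comm x y z := by
    obtain ⟨y, rfl⟩ := MulOpposite.op_surjective y
    induction x with
    | zero => simp only [map_zero, LinearMap.zero_apply]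
    | add x x' hx hx' => simp only [map_add, LinearMap.add_apply, hx, hx']
    | tmul a a' =>
      induction y with
      | zero => simp only [MulOpposite.op_zero, map_zero, LinearMap.zero_apply]
      | add y y' hy hy' => simp only [MulOpposite.op_add, map_add, LinearMap.add_apply, hy, hy']
      | tmul b b' =>
        induction z with
        | zero => simp only [map_zero]
        | add z z' hz hz' => simp only [map_add, hz, hz']
        | tmul p p' => simp [P.comm, P'.comm]
  rep := P.rep.tprod P'.rep
  rep_left g x z := by
    induction x with
    | zero => simp only [map_zero, LinearMap.zero_apply]
    | add x x' hx hx' => simp only [map_add, LinearMap.add_apply, hx, hx']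
    | tmul a a' =>
      induction z with
      | zero => simp only [map_zero]
      | add z z' hz hz' => simp only [map_add, hz, hz']
      | tmul p p' => simp [AlgAction.tensor, P.rep_left, P'.rep_left]
  rep_right g y z := by
    induction y with
    | zero => simp only [MulOpposite.op_zero, map_zero, LinearMap.zero_apply]
    | add y y' hy hy' => simp only [MulOpposite.op_add, map_add, LinearMap.add_apply, hy, hy']
    | tmul b b' =>
      induction z with
      | zero => simp only [map_zero]
      | add z z' hz hz' => simp only [map_add, hz, hz']
      | tmul p p' => simp [AlgAction.tensor, P.rep_right, P'.rep_right]

variable {P : GPrebimodule α β} {Q : GPrebimodule β α} {P' : GPrebimodule α' β'}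
  {Q' : GPrebimodule β' α'}

/-- The element `p ⊗ p'` of the bimodule `P ⊗ P'`. -/
noncomputable def GPrebimodule.externalTmul (P : GPrebimodule α β) (P' : GPrebimodule α' β') :
    P.carrier →ₗ[k] P'.carrier →ₗ[k] (P.external P').carrier :=
  TensorProduct.mk k P.carrier P'.carrier

@[elab_as_elim]
theorem GPrebimodule.external_induction {P : GPrebimodule α β} {P' : GPrebimodule α' β'}
    {motive : (P.external P').carrier → Prop} (tmul : ∀ p p', motive (P.externalTmul P' p p'))
    (add : ∀ x y, motive x → motive y → motive (x + y)) (x : (P.external P').carrier) :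
    motive x :=
  generates_mk.induction tmul add x

/-- The bilinear map `(p ⊗ p', q ⊗ q') ↦ f(p, q) ⊗ f'(p', q')`. -/
noncomputable def GPairing.externalBilin (f : GPairing P Q) (f' : GPairing P' Q') :
    (P.external P').carrier →ₗ[k] (Q.external Q').carrier →ₗ[k] A ⊗[k] A' :=
  TensorProduct.map₂ f.bilin f'.bilin

theorem GPairing.externalBilin_left (f : GPairing P Q) (f' : GPairing P' Q') (a : A ⊗[k] A')
    (x : (P.external P').carrier) (y : (Q.external Q').carrier) :
    f.externalBilin f' ((P.external P').left a x) y = a * f.externalBilin f' x y := by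
  induction a with
  | zero => simp only [map_zero, LinearMap.zero_apply, zero_mul]
  | add a a' ha ha' => simp only [map_add, LinearMap.add_apply, add_mul, ha, ha']
  | tmul a a' =>
    induction x using GPrebimodule.external_induction with
    | add x x' hx hx' => simp only [map_add, LinearMap.add_apply, mul_add, hx, hx']
    | tmul p p' =>
      induction y using GPrebimodule.external_induction with
      | add y y' hy hy' => simp only [map_add, mul_add, hy, hy']
      | tmul q q' =>
        exact (congrArg₂ (· ⊗ₜ[k] ·) (f.map_left a p q) (f'.map_left a' p' q')).trans
          (Algebra.TensorProduct.tmul_mul_tmul a _ a' _).symm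

theorem GPairing.externalBilin_right (f : GPairing P Q) (f' : GPairing P' Q') (a : A ⊗[k] A')
    (x : (P.external P').carrier) (y : (Q.external Q').carrier) :
    f.externalBilin f' x ((Q.external Q').right (MulOpposite.op a) y) =
      f.externalBilin f' x y * a := by
  induction a with
  | zero => simp only [MulOpposite.op_zero, map_zero, LinearMap.zero_apply, mul_zero]
  | add a a' ha ha' =>
    simp only [MulOpposite.op_add, map_add, LinearMap.add_apply, mul_add, ha, ha']
  | tmul a a' =>
    induction x using GPrebimodule.external_induction with
    | add x x' hx hx' => simp only [map_add, LinearMap.add_apply, add_mul, hx, hx']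
    | tmul p p' =>
      induction y using GPrebimodule.external_induction with
      | add y y' hy hy' => simp only [map_add, add_mul, hy, hy']
      | tmul q q' =>
        exact (congrArg₂ (· ⊗ₜ[k] ·) (f.map_right a p q) (f'.map_right a' p' q')).trans
          (Algebra.TensorProduct.tmul_mul_tmul _ a _ a').symm

/-- The tensor product of two bimodule maps. -/
noncomputable def GPairing.external (f : GPairing P Q) (f' : GPairing P' Q') :
    GPairing (P.external P') (Q.external Q') where
  bilin := f.externalBilin f'
  balanced b x y := by
    induction b with
    | zero => simp only [MulOpposite.op_zero, map_zero, LinearMap.zero_apply]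
    | add b b' hb hb' => simp only [MulOpposite.op_add, map_add, LinearMap.add_apply, hb, hb']
    | tmul b b' =>
      induction x using GPrebimodule.external_induction with
      | add x x' hx hx' => simp only [map_add, LinearMap.add_apply, hx, hx']
      | tmul p p' =>
        induction y using GPrebimodule.external_induction with
        | add y y' hy hy' => simp only [map_add, hy, hy']
        | tmul q q' => exact congrArg₂ (· ⊗ₜ[k] ·) (f.balanced b p q) (f'.balanced b' p' q')
  map_left := f.externalBilin_left f'
  map_right := f.externalBilin_right f'
  equivariant g x y := by
    induction x using GPrebimodule.external_induction with
    | add x x' hx hx' => simp only [map_add, LinearMap.add_apply, hx, hx']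
    | tmul p p' =>
      induction y using GPrebimodule.external_induction with
      | add y y' hy hy' => simp only [map_add, hy, hy']
      | tmul q q' => exact congrArg₂ (· ⊗ₜ[k] ·) (f.equivariant g p q) (f'.equivariant g p' q')

theorem GPairing.external_generates {f : GPairing P Q} {f' : GPairing P' Q'}
    (hf : Generates f.bilin) (hf' : Generates f'.bilin) :
    Generates (f.external f').bilin := fun S hS =>
  generates_mk S fun a a' => by
    induction a using hf.induction with
    | add a b ha hb => simpa only [map_add, LinearMap.add_apply] using S.add_mem ha hb
    | apply p q =>
      exact hf' (S.comap (TensorProduct.mk k A A' (f.bilin p q)))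
        (fun p' q' => hS (p ⊗ₜ p') (q ⊗ₜ q')) a'

theorem GPairing.Compatible.external {f : GPairing P Q} {h : GPairing Q P} {f' : GPairing P' Q'}
    {h' : GPairing Q' P'} (hfh : f.Compatible h) (hfh' : f'.Compatible h') :
    (f.external f').Compatible (h.external h') := fun x y z => by
  induction x using GPrebimodule.external_induction with
  | add x x' hx hx' => simp only [map_add, LinearMap.add_apply, hx, hx']
  | tmul p p' =>
    induction y using GPrebimodule.external_induction with
    | add y y' hy hy' => simp only [map_add, MulOpposite.op_add, LinearMap.add_apply, hy, hy']
    | tmul q q' =>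
      induction z using GPrebimodule.external_induction with
      | add z z' hz hz' => simp only [map_add, MulOpposite.op_add, LinearMap.add_apply, hz, hz']
      | tmul r r' => exact congrArg₂ (· ⊗ₜ[k] ·) (hfh p q r) (hfh' p' q' r')

/-- The tensor product of two Morita contexts. -/
noncomputable def GMoritaContext.external (c : GMoritaContext α β) (d : GMoritaContext α' β') :
    GMoritaContext (α.tensor α') (β.tensor β') where
  P := c.P.external d.P
  Q := c.Q.external d.Q
  f := c.f.external d.f
  h := c.h.external d.h
  assoc_P := c.assoc_P.external d.assoc_P
  assoc_Q := c.assoc_Q.external d.assoc_Q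
  P_generates := c.P_generates.externalAction d.P_generates
  Q_generates := c.Q_generates.externalAction d.Q_generates
  f_generates := GPairing.external_generates c.f_generates d.f_generates
  h_generates := GPairing.external_generates c.h_generates d.h_generates

end ExternalTensor

/-! ### Contexts from isomorphisms and from dual pairs -/

section Iso

variable {k : Type u} [CommRing k] {G : Type v} [Group G] {A B C : Type u}
  [NonUnitalRing A] [Module k A] [NonUnitalRing B] [Module k B] [NonUnitalRing C] [Module k C]
  {α : AlgAction k G A} {β : AlgAction k G B} {γ : AlgAction k G C}

namespace AlgAction.Iso

/-- The identity isomorphism. -/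
def refl (α : AlgAction k G A) : α.Iso α where
  toEquiv := LinearEquiv.refl k A
  map_mul _ _ := rfl
  equivariant _ _ := rfl

/-- The inverse isomorphism. -/
def symm (e : α.Iso β) : β.Iso α where
  toEquiv := e.toEquiv.symm
  map_mul a b := e.toEquiv.injective (by simp [e.map_mul])
  equivariant g a := e.toEquiv.injective (by simp [e.equivariant])

/-- The composite of two isomorphisms. -/
def trans (e : α.Iso β) (e' : β.Iso γ) : α.Iso γ where
  toEquiv := e.toEquiv.trans e'.toEquiv
  map_mul a b := by simp [e.map_mul, e'.map_mul]
  equivariant g a := by simp [e.equivariant, e'.equivariant]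

/-- An isomorphism of `G`-module algebras as an algebra map. -/
def toHom (e : α.Iso β) : A →ₙₐ[k] B where
  __ := e.toEquiv.toLinearMap
  map_zero' := map_zero e.toEquiv
  map_mul' := e.map_mul

end AlgAction.Iso

variable [IsScalarTower k A A] [SMulCommClass k A A] [IsScalarTower k B B] [SMulCommClass k B B]

/-- The algebra `B` as an `A`-`B`-bimodule, for an isomorphism `e : A ≅ B`. -/
def GPrebimodule.ofIso (e : α.Iso β) : GPrebimodule α β where
  carrier := B
  left := (NonUnitalAlgHom.lmul k B).comp e.toHom
  right := rightRegular k B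
  comm a b x := lmul_rightRegular_comm (e.toEquiv a) b x
  rep := β.rep
  rep_left g a x := by
    change β.rep g (e.toEquiv a * x) = e.toEquiv (α.rep g a) * β.rep g x
    rw [β.map_mul, e.equivariant]
  rep_right g b x := β.map_mul g x b

/-- The pairing `(b, a) ↦ e⁻¹(b) a`. -/
def GPairing.ofIso (e : α.Iso β) : GPairing (GPrebimodule.ofIso e) (GPrebimodule.ofIso e.symm) where
  bilin := (LinearMap.mul k A) ∘ₗ e.toEquiv.symm.toLinearMap
  balanced b (x : B) (y : A) := by
    change e.symm.toEquiv (x * b) * y = e.symm.toEquiv x * (e.symm.toEquiv b * y)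
    rw [e.symm.map_mul, mul_assoc]
  map_left a (x : B) (y : A) := by
    change e.toEquiv.symm (e.toEquiv a * x) * y = a * (e.toEquiv.symm x * y)
    rw [← mul_assoc]
    congr 1
    rw [e.toEquiv.symm_apply_eq, e.map_mul, e.toEquiv.apply_symm_apply]
  map_right a _ (y : A) := (mul_assoc (G := A) _ y a).symm
  equivariant g (x : B) (y : A) := by
    change e.symm.toEquiv (β.rep g x) * α.rep g y = α.rep g (e.symm.toEquiv x * y)
    rw [e.symm.equivariant, α.map_mul]

theorem GPairing.ofIso_compatible (e : α.Iso β) :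
    (GPairing.ofIso e).Compatible (GPairing.ofIso e.symm) := fun (x : B) (y : A) (x' : B) => by
  change e.toEquiv (e.toEquiv.symm x * y) * x' = x * (e.toEquiv y * x')
  rw [e.map_mul, e.toEquiv.apply_symm_apply, mul_assoc]

theorem lmul_generates_of_iso (e : α.Iso β) (hA : ActionGenerates (NonUnitalAlgHom.lmul k A)) :
    ActionGenerates (NonUnitalAlgHom.lmul k B) := fun S hS b => by
  have := hA (S.comap e.toEquiv.toLinearMap) (fun a a' => by
    change e.toEquiv (a * a') ∈ S
    exact e.map_mul a a' ▸ hS _ _) (e.toEquiv.symm b)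
  simpa using this

theorem GPrebimodule.ofIso_left_generates (e : α.Iso β)
    (hA : ActionGenerates (NonUnitalAlgHom.lmul k A)) :
    ActionGenerates (GPrebimodule.ofIso e).left := fun S hS =>
  lmul_generates_of_iso e hA S fun b b' =>
    e.toEquiv.apply_symm_apply b ▸ hS (e.toEquiv.symm b) b'

theorem GPrebimodule.isFirm_ofIso_left (e : α.Iso β) (hA : IsFirm (NonUnitalAlgHom.lmul k A)) :
    IsFirm (GPrebimodule.ofIso e).left :=
  hA.congr e.toEquiv e.map_mul

theorem GPairing.ofIso_generates (e : α.Iso β) (hA : ActionGenerates (NonUnitalAlgHom.lmul k A)) :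
    Generates (GPairing.ofIso e).bilin := fun S hS =>
  hA S fun a a' => e.toEquiv.symm_apply_apply a ▸ hS (e.toEquiv a) a'

/-- The Morita context of an isomorphism `A ≅ B`, with bimodules `B` and `A`. -/
def GMoritaContext.ofIso (e : α.Iso β) (hA : ActionGenerates (NonUnitalAlgHom.lmul k A)) :
    GMoritaContext α β where
  P := GPrebimodule.ofIso e
  Q := GPrebimodule.ofIso e.symm
  f := GPairing.ofIso e
  h := GPairing.ofIso e.symm
  assoc_P := GPairing.ofIso_compatible e
  assoc_Q := GPairing.ofIso_compatible e.symm
  P_generates := GPrebimodule.ofIso_left_generates e hA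
  Q_generates := GPrebimodule.ofIso_left_generates e.symm (lmul_generates_of_iso e hA)
  f_generates := GPairing.ofIso_generates e hA
  h_generates := GPairing.ofIso_generates e.symm (lmul_generates_of_iso e hA)

end Iso

section Elementary

variable {k : Type u} [CommRing k]

variable (k) in
/-- The left action of `k` on a `k`-module. -/
def scalarLeft (M : Type u) [AddCommGroup M] [Module k M] : k →ₙₐ[k] Module.End k M where
  __ := LinearMap.lsmul k M
  map_zero' := map_zero (LinearMap.lsmul k M)
  map_mul' a b := LinearMap.ext fun m => mul_smul a b m

variable (k) in
/-- The right action of `k` on a `k`-module. -/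
def scalarRight (M : Type u) [AddCommGroup M] [Module k M] : kᵐᵒᵖ →ₙₐ[k] Module.End k M where
  toFun c := LinearMap.lsmul k M c.unop
  map_smul' a b := map_smul (LinearMap.lsmul k M) a b.unop
  map_zero' := map_zero (LinearMap.lsmul k M)
  map_add' a b := map_add (LinearMap.lsmul k M) a.unop b.unop
  map_mul' a b := LinearMap.ext fun m => by
    change (b.unop * a.unop) • m = a.unop • b.unop • m
    rw [mul_smul, smul_comm]

namespace Elem

variable (p : DualPair k)

/-- `Elem.tmul` as a bilinear map. -/
noncomputable def tmulBilin : p.M →ₗ[k] p.M' →ₗ[k] Elem p :=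
  TensorProduct.mk k p.M p.M'

theorem tmulBilin_generates : Generates (tmulBilin p) :=
  generates_mk

/-- `M` as a left module over `E(M)`. -/
noncomputable def leftAction : Elem p →ₙₐ[k] Module.End k p.M where
  toFun := act p
  map_smul' := map_smul (act p)
  map_zero' := map_zero (act p)
  map_add' := map_add (act p)
  map_mul' := act_mul p

/-- The right action of `M ⊗ M'` on `M'`: `n' (m ⊗ m') = μ(n' ⊗ m) m'`. -/
noncomputable def coact : Elem p →ₗ[k] Module.End k p.M' :=
  TensorProduct.lift (LinearMap.mk₂ k
    (fun m m' => LinearMap.toSpanSingleton k p.M' m' ∘ₗ p.μ ∘ₗ (TensorProduct.mk k p.M' p.M).flip m)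
    (fun m n m' => by ext x; simp [add_smul])
    (fun c m m' => by ext x; simp [mul_smul])
    (fun m m' n' => by ext x; simp)
    (fun c m m' => by ext x; simp [smul_comm c]))

theorem coact_tmul (m : p.M) (m' n' : p.M') :
    coact p (tmul p m m') n' = p.μ (n' ⊗ₜ m) • m' := rfl

theorem coact_mul (x y : Elem p) (n' : p.M') : coact p (x * y) n' = coact p y (coact p x n') := by
  induction x using (tmulBilin_generates p).induction with
  | add x x' hx hx' => simp only [add_mul, map_add, LinearMap.add_apply, hx, hx']
  | apply a a' =>
    induction y using (tmulBilin_generates p).induction with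
    | add y y' hy hy' => simp only [mul_add, map_add, LinearMap.add_apply, hy, hy']
    | apply b b' =>
      change coact p (tmul p a a' * tmul p b b') n' = p.μ ((p.μ (n' ⊗ₜ a) • a') ⊗ₜ b) • b'
      rw [tmul_mul_tmul, map_smul, LinearMap.smul_apply, coact_tmul, ← TensorProduct.smul_tmul',
        map_smul, smul_eq_mul, smul_smul, mul_comm]

theorem μ_coact (x : Elem p) (n' : p.M') (n : p.M) :
    p.μ (coact p x n' ⊗ₜ n) = p.μ (n' ⊗ₜ leftAction p x n) := by
  induction x using (tmulBilin_generates p).induction with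
  | add x x' hx hx' =>
    simp only [map_add, LinearMap.add_apply, TensorProduct.add_tmul, TensorProduct.tmul_add, hx,
      hx']
  | apply a a' =>
    change p.μ ((p.μ (n' ⊗ₜ a) • a') ⊗ₜ n) = p.μ (n' ⊗ₜ (p.μ (a' ⊗ₜ n) • a))
    rw [← TensorProduct.smul_tmul', TensorProduct.tmul_smul, map_smul, map_smul, smul_eq_mul,
      smul_eq_mul, mul_comm]

theorem tmul_coact (x : Elem p) (n : p.M) (n' : p.M') :
    tmulBilin p n (coact p x n') = tmulBilin p n n' * x := by
  induction x using (tmulBilin_generates p).induction with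
  | add x x' hx hx' => simp only [map_add, LinearMap.add_apply, mul_add, hx, hx']
  | apply a a' =>
    refine Eq.trans ?_ (tmul_mul_tmul p n a n' a').symm
    exact map_smul (tmulBilin p n) (p.μ (n' ⊗ₜ a)) a'

/-- `M'` as a right module over `E(M)`. -/
noncomputable def rightAction : (Elem p)ᵐᵒᵖ →ₙₐ[k] Module.End k p.M' where
  toFun x := coact p x.unop
  map_smul' c x := map_smul (coact p) c x.unop
  map_zero' := map_zero (coact p)
  map_add' x y := map_add (coact p) x.unop y.unop
  map_mul' x y := LinearMap.ext (coact_mul p y.unop x.unop)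

end Elem

variable {G : Type v} [Group G]

variable (k G) in
/-- The trivial `G`-module algebra `k`. -/
def AlgAction.trivial : AlgAction k G k where
  rep := Representation.trivial k G k
  map_mul _ _ _ := rfl

namespace GDualPair

variable (p : GDualPair k G)

/-- `M'` as a `k`-`E(M)`-bimodule. -/
noncomputable def leftBimodule : GPrebimodule (AlgAction.trivial k G) p.algAction where
  carrier := p.M'
  left := scalarLeft k p.M'
  right := Elem.rightAction p.toDualPair
  comm c x n := (map_smul (Elem.rightAction p.toDualPair x) c n).symm
  rep := p.rep'
  rep_left g c n := map_smul (p.rep' g) c n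
  rep_right g x n := by
    induction x using (Elem.tmulBilin_generates p.toDualPair).induction with
    | add x x' hx hx' => simp only [MulOpposite.op_add, map_add, LinearMap.add_apply, hx, hx']
    | apply m m' =>
      change p.rep' g (p.μ (n ⊗ₜ m) • m') = p.μ (p.rep' g n ⊗ₜ p.rep g m) • p.rep' g m'
      rw [map_smul, p.invariant]

/-- `M` as an `E(M)`-`k`-bimodule. -/
noncomputable def rightBimodule : GPrebimodule p.algAction (AlgAction.trivial k G) where
  carrier := p.M
  left := Elem.leftAction p.toDualPair
  right := scalarRight k p.M
  comm x c n := map_smul (Elem.leftAction p.toDualPair x) c.unop n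
  rep := p.rep
  rep_left g x n := by
    induction x using (Elem.tmulBilin_generates p.toDualPair).induction with
    | add x x' hx hx' => simp only [map_add, LinearMap.add_apply, hx, hx']
    | apply m m' =>
      change p.rep g (p.μ (m' ⊗ₜ n) • m) = p.μ (p.rep' g m' ⊗ₜ p.rep g n) • p.rep g m
      rw [map_smul, p.invariant]
  rep_right g c n := map_smul (p.rep g) c n

/-- The form `μ` as a bimodule map `M' ⊗ M → k`. -/
noncomputable def pairing : GPairing p.leftBimodule p.rightBimodule where
  bilin := TensorProduct.curry p.μ
  balanced x n m := Elem.μ_coact p.toDualPair x n m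
  map_left c (n : p.M') (m : p.M) := map_smul p.μ c (n ⊗ₜ m)
  map_right c (n : p.M') (m : p.M) := by
    change p.μ (n ⊗ₜ (c • m)) = p.μ (n ⊗ₜ m) * c
    rw [TensorProduct.tmul_smul, map_smul, smul_eq_mul, mul_comm]
  equivariant g n m := p.invariant g n m

/-- The canonical bimodule map `M ⊗ M' → E(M)`. -/
noncomputable def copairing : GPairing p.rightBimodule p.leftBimodule where
  bilin := Elem.tmulBilin p.toDualPair
  balanced c m n := TensorProduct.smul_tmul (R := k) c m n
  map_left _ _ _ := rfl
  map_right x m n := Elem.tmul_coact p.toDualPair x m n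
  equivariant _ _ _ := rfl

theorem rightBimodule_left_generates : ActionGenerates p.rightBimodule.left := fun S hS m => by
  suffices h : ∀ z, p.μ z • m ∈ S by
    obtain ⟨z, hz⟩ := p.surjective 1
    exact one_smul k m ▸ hz ▸ h z
  refine generates_mk (S.comap (LinearMap.toSpanSingleton k p.M m ∘ₗ p.μ)) fun m' n => ?_
  exact hS (Elem.tmul p.toDualPair m m') n

/-- The Morita context between `k` and `E(M)`. -/
noncomputable def context : GMoritaContext (AlgAction.trivial k G) p.algAction where
  P := p.leftBimodule
  Q := p.rightBimodule
  f := p.pairing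
  h := p.copairing
  assoc_P _ _ _ := rfl
  assoc_Q _ _ _ := rfl
  P_generates S hS n := one_smul k n ▸ hS 1 n
  Q_generates := p.rightBimodule_left_generates
  f_generates S hS c := by
    obtain ⟨z, rfl⟩ := p.surjective c
    exact generates_mk (S.comap p.μ) hS z
  h_generates := Elem.tmulBilin_generates p.toDualPair

end GDualPair

end Elementary

/-! ### Stability under tensoring with elementary algebras -/

section IsoTensor

variable {k : Type u} [CommRing k] {G : Type v} [Group G] {A B C : Type u}
  [NonUnitalRing A] [Module k A] [IsScalarTower k A A] [SMulCommClass k A A]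
  [NonUnitalRing B] [Module k B] [IsScalarTower k B B] [SMulCommClass k B B]
  [NonUnitalRing C] [Module k C] [IsScalarTower k C C] [SMulCommClass k C C]

namespace AlgAction.Iso

variable {α : AlgAction k G A} {β : AlgAction k G B}

/-- `C ⊗ A ≅ C ⊗ B`, for `A ≅ B`. -/
noncomputable def lTensor (γ : AlgAction k G C) (e : α.Iso β) :
    (γ.tensor α).Iso (γ.tensor β) where
  toEquiv := e.toEquiv.lTensor C
  map_mul := map_mul_of_generates generates_mk (f := (e.toEquiv.lTensor C).toLinearMap)
    fun c a c' a' => by simp [e.map_mul]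
  equivariant g x := by
    induction x with
    | zero => simp only [map_zero]
    | add x y hx hy => simp only [map_add, hx, hy]
    | tmul c a => exact congrArg (γ.rep g c ⊗ₜ[k] ·) (e.equivariant g a)

variable (α) in
/-- `A ≅ A ⊗ k`. -/
noncomputable def rightUnit : α.Iso (α.tensor (AlgAction.trivial k G)) where
  toEquiv := (TensorProduct.rid k A).symm
  map_mul a b := by simp
  equivariant _ _ := rfl

/-- `A ⊗ (B ⊗ C) ≅ B ⊗ (A ⊗ C)`. -/
noncomputable def leftComm (α : AlgAction k G A) (β : AlgAction k G B) (γ : AlgAction k G C) :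
    (α.tensor (β.tensor γ)).Iso (β.tensor (α.tensor γ)) where
  toEquiv := TensorProduct.leftComm k A B C
  map_mul := by
    refine map_mul_of_generates (A := A ⊗[k] (B ⊗[k] C)) (B := B ⊗[k] (A ⊗[k] C)) generates_mk
      (f := (TensorProduct.leftComm k A B C).toLinearMap) fun a x a' x' => ?_
    induction x with
    | zero => simp
    | add x y hx hy =>
      simp only [map_add, add_mul, hx, hy]
    | tmul b c =>
      induction x' with
      | zero => simp
      | add x y hx hy => simp only [map_add, mul_add, hx, hy]
      | tmul b' c' => simp
  equivariant g x := by
    induction x with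
    | zero => simp only [map_zero]
    | add x y hx hy => simp only [map_add, hx, hy]
    | tmul a x =>
      induction x with
      | zero => simp only [TensorProduct.tmul_zero, map_zero]
      | add x y hx hy => simp only [TensorProduct.tmul_add, map_add, hx, hy]
      | tmul b c => rfl

end AlgAction.Iso

end IsoTensor

section Stable

variable {k : Type u} [CommRing k] {G : Type v} [Group G] {A B : Type u}
  [NonUnitalRing A] [Module k A] [IsScalarTower k A A] [SMulCommClass k A A]
  [NonUnitalRing B] [Module k B] [IsScalarTower k B B] [SMulCommClass k B B]
  {α : AlgAction k G A} {β : AlgAction k G B}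

/-- The Morita context between `A` and `A ⊗ E(M)`. -/
noncomputable def GMoritaContext.tensorElementary (hA : ActionGenerates (NonUnitalAlgHom.lmul k A))
    (p : GDualPair k G) : GMoritaContext α (α.tensor p.algAction) :=
  (GMoritaContext.ofIso (AlgAction.Iso.rightUnit α) hA).trans
    ((GMoritaContext.ofIso (AlgAction.Iso.refl α) hA).external p.context)

theorem GMoritaContext.isFirm_tensorElementary_left (hA : IsFirm (NonUnitalAlgHom.lmul k A))
    (p : GDualPair k G) :
    IsFirm (GMoritaContext.tensorElementary (α := α) hA.generates p).P.left :=
  GPrebimodule.isFirm_tensor_left (GPrebimodule.isFirm_ofIso_left _ hA) _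

theorem moritaEquivalent_of_iso_tensor_elementary (hA : IsFirm (NonUnitalAlgHom.lmul k A))
    (hB : IsFirm (NonUnitalAlgHom.lmul k B)) {p q : GDualPair k G}
    (e : (α.tensor p.algAction).Iso (β.tensor q.algAction)) :
    Nonempty (StrictGMoritaContext α β) :=
  let c := GMoritaContext.tensorElementary (α := α) hA.generates p
  let d := GMoritaContext.tensorElementary (α := β) hB.generates q
  ⟨((c.trans (.ofIso e c.lmul_generates_right)).trans d.symm).toStrict hA hB
    (GPrebimodule.isFirm_tensor_left (GPrebimodule.isFirm_tensor_left
      (GMoritaContext.isFirm_tensorElementary_left hA p) _) _)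
    (GPrebimodule.isFirm_tensor_left (GMoritaContext.isFirm_tensorElementary_left hB q) _)⟩

end Stable

/-! ### Opposites of elementary algebras -/

section Opposite

variable {k : Type u} [CommRing k] {G : Type v} [Group G]

namespace GDualPair

/-- The dual pair `(M', M)`, with the form `m ⊗ m' ↦ μ(m' ⊗ m)`. -/
def swap (p : GDualPair k G) : GDualPair k G where
  M := p.M'
  M' := p.M
  μ := p.μ ∘ₗ (TensorProduct.comm k p.M p.M').toLinearMap
  surjective := p.surjective.comp (TensorProduct.comm k p.M p.M').surjective
  rep := p.rep'
  rep' := p.rep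
  invariant g m m' := p.invariant g m' m

/-- The linear map `m' ⊗ m ↦ m ⊗ m'` from `E(M', M)` to `E(M, M')ᵒᵖ`. -/
noncomputable def swapEquiv (p : GDualPair k G) :
    Elem p.swap.toDualPair ≃ₗ[k] (Elem p.toDualPair)ᵐᵒᵖ :=
  (TensorProduct.comm k p.M' p.M).trans
    (MulOpposite.opLinearEquiv k : Elem p.toDualPair ≃ₗ[k] (Elem p.toDualPair)ᵐᵒᵖ)

/-- `E(M', M) ≅ E(M, M')ᵒᵖ`. -/
noncomputable def swapIso (p : GDualPair k G) : p.swap.algAction.Iso p.algAction.op where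
  toEquiv := p.swapEquiv
  map_mul := map_mul_of_generates (Elem.tmulBilin_generates p.swap.toDualPair)
    (f := p.swapEquiv.toLinearMap) fun (m' : p.M') (m : p.M) (n' : p.M') (n : p.M) =>
      congrArg MulOpposite.op
        ((map_smul (Elem.tmulBilin p.toDualPair n) (p.μ (n' ⊗ₜ[k] m)) m').trans
          (Elem.tmul_mul_tmul p.toDualPair n m n' m').symm)
  equivariant g x := by
    induction x using (Elem.tmulBilin_generates p.swap.toDualPair).induction with
    | add x x' hx hx' => simp only [map_add, hx, hx']
    | apply m' m => rfl

end GDualPair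

variable {A B : Type u} [NonUnitalRing A] [Module k A] [NonUnitalRing B] [Module k B]
  {α : AlgAction k G A} {β : AlgAction k G B}

/-- An isomorphism `A ≅ B` as an isomorphism `Aᵒᵖ ≅ Bᵒᵖ`. -/
def AlgAction.Iso.op (e : α.Iso β) : α.op.Iso β.op where
  toEquiv := (MulOpposite.opLinearEquiv k).symm.trans
    (e.toEquiv.trans (MulOpposite.opLinearEquiv k))
  map_mul a b := congrArg MulOpposite.op (e.map_mul b.unop a.unop)
  equivariant g a := congrArg MulOpposite.op (e.equivariant g a.unop)

theorem IsElementary.congr (hβ : IsElementary β) (e : α.Iso β) : IsElementary α :=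
  let ⟨p, ⟨e'⟩⟩ := hβ
  ⟨p, ⟨e.trans e'⟩⟩

theorem IsElementary.op (hα : IsElementary α) : IsElementary α.op :=
  let ⟨p, ⟨e⟩⟩ := hα
  ⟨p.swap, ⟨e.op.trans p.swapIso.symm⟩⟩

variable [IsScalarTower k A A] [SMulCommClass k A A] [IsScalarTower k B B] [SMulCommClass k B B]

variable (α β) in
/-- `B ⊗ Aᵒᵖ ≅ (A ⊗ Bᵒᵖ)ᵒᵖ`. -/
noncomputable def AlgAction.Iso.tensorOp : (β.tensor α.op).Iso (α.tensor β.op).op where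
  toEquiv := (TensorProduct.congr (MulOpposite.opLinearEquiv k)
    (MulOpposite.opLinearEquiv k).symm).trans
      ((TensorProduct.comm k Bᵐᵒᵖ A).trans (MulOpposite.opLinearEquiv k))
  map_mul := map_mul_of_generates generates_mk
    (f := ((TensorProduct.congr (MulOpposite.opLinearEquiv k)
      (MulOpposite.opLinearEquiv k).symm).trans
        ((TensorProduct.comm k Bᵐᵒᵖ A).trans (MulOpposite.opLinearEquiv k))).toLinearMap)
    fun b a b' a' => by simp [← MulOpposite.op_mul]
  equivariant g x := by
    induction x with
    | zero => simp only [map_zero]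
    | add x y hx hy => simp only [map_add, hx, hy]
    | tmul b a => rfl

theorem IsElementary.tensor_op_swap (h : IsElementary (α.tensor β.op)) :
    IsElementary (β.tensor α.op) :=
  h.op.congr (AlgAction.Iso.tensorOp α β)

end Opposite

/-! ### Taylor–Azumaya algebras -/

section TaylorAzumaya

variable {k A : Type u} [CommRing k]
  [NonUnitalRing A] [Module k A] [IsScalarTower k A A] [SMulCommClass k A A]

theorem IsTaylorAzumaya.exists_eq_smul (hA : IsTaylorAzumaya k A) {θ : A →ₗ[k] A}
    (hl : ∀ a x, θ (a * x) = a * θ x) (hr : ∀ a x, θ (x * a) = θ x * a) :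
    ∃ r : k, ∀ x, θ x = r • x := by
  obtain ⟨r, hr'⟩ := (hA.unit_bijective k).surjective
    ⟨(TensorProduct.mk k A k).flip 1 ∘ₗ θ, fun z x => by
      induction z with
      | zero => simp only [map_zero, LinearMap.zero_apply]
      | add z w hz hw => simp only [map_add, LinearMap.add_apply, hz, hw]
      | tmul a b =>
        change θ (a * (x * b.unop)) ⊗ₜ[k] (1 : k) = (a * (θ x * b.unop)) ⊗ₜ 1
        rw [hl, hr]⟩
  refine ⟨r, fun x => ?_⟩
  have hx : x ⊗ₜ[k] r = θ x ⊗ₜ[k] (1 : k) := LinearMap.congr_fun (congrArg Subtype.val hr') x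
  simpa using (congrArg (TensorProduct.rid k A) hx).symm

theorem IsTaylorAzumaya.eq_top_of_smul_eq_top (hA : IsTaylorAzumaya k A) {I : Ideal k}
    (hI : I • (⊤ : Submodule k A) = ⊤) : I = ⊤ := by
  have tmul_one_eq_zero (a : A) : a ⊗ₜ[k] (1 : k ⧸ I) = 0 := by
    induction hI ▸ Submodule.mem_top (x := a) using Submodule.smul_induction_on' with
    | smul r hr a _ =>
      rw [TensorProduct.smul_tmul, Algebra.smul_def, mul_one, Ideal.Quotient.algebraMap_eq,
        Ideal.Quotient.eq_zero_iff_mem.2 hr, TensorProduct.tmul_zero]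
    | add a _ b _ ha hb => rw [TensorProduct.add_tmul, ha, hb, add_zero]
  have one_eq_zero : (1 : k ⧸ I) = 0 := (hA.unit_bijective (k ⧸ I)).injective <| by
    rw [map_zero]
    exact Subtype.ext (LinearMap.ext tmul_one_eq_zero)
  exact (Ideal.eq_top_iff_one I).2 (Ideal.Quotient.eq_zero_iff_mem.1 one_eq_zero)

theorem exists_eq_smul_of_forall_exists {V P : Type*} [AddCommGroup V] [Module k V]
    [AddCommGroup P] [Module k P] [FaithfulSMul k P] {W : Type*} [AddCommGroup W] [Module k W]
    (T : V →ₗ[k] W →ₗ[k] Module.End k P) (hT : ∀ v w, ∃ r : k, ∀ x, T v w x = r • x) :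
    ∃ μ : V ⊗[k] W →ₗ[k] k, ∀ v w x, T v w x = μ (v ⊗ₜ w) • x := by
  let scalars := Algebra.linearMap k (Module.End k P)
  have injective_scalars : Function.Injective scalars := fun r s h =>
    FaithfulSMul.eq_of_smul_eq_smul (α := P) fun x => LinearMap.congr_fun h x
  have mem_range (t : V ⊗[k] W) : TensorProduct.lift T t ∈ LinearMap.range scalars :=
    generates_mk ((LinearMap.range scalars).comap (TensorProduct.lift T)) (fun v w =>
      (hT v w).imp fun _ hr => LinearMap.ext fun x => (hr x).symm) t
  let e := LinearEquiv.ofInjective scalars injective_scalars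
  refine ⟨e.symm.toLinearMap ∘ₗ (TensorProduct.lift T).codRestrict _ mem_range, fun v w x => ?_⟩
  have hvw := congrArg Subtype.val (e.apply_symm_apply ⟨TensorProduct.lift T (v ⊗ₜ w), mem_range _⟩)
  exact (LinearMap.congr_fun hvw x).symm

end TaylorAzumaya

/-! ### Contexts over Taylor–Azumaya algebras -/

section Contraction

variable {k : Type u} [CommRing k] {G : Type v} [Group G] {A B : Type u}
  [NonUnitalRing A] [Module k A] [NonUnitalRing B] [Module k B]
  {α : AlgAction k G A} {β : AlgAction k G B}

/-- The map `A ⊗ N → P ⊗ N`, `a ⊗ n ↦ a p ⊗ n`, for `p` in `P`. -/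
noncomputable def GPrebimodule.actTensor (P : GPrebimodule α β) (N : Type*) [AddCommGroup N]
    [Module k N] : P.carrier →ₗ[k] A ⊗[k] N →ₗ[k] P.carrier ⊗[k] N :=
  LinearMap.rTensorHom N ∘ₗ (P.left : A →ₗ[k] Module.End k P.carrier).flip

theorem GPrebimodule.actTensor_left (P : GPrebimodule α β) {N : Type*} [AddCommGroup N]
    [Module k N] [IsScalarTower k A A] [SMulCommClass k A A] (a : A) (p : P.carrier)
    (z : A ⊗[k] N) : P.actTensor N (P.left a p) z =
      P.actTensor N p (tensorAction (rightRegular k A) N (MulOpposite.op a) z) := by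
  induction z with
  | zero => simp only [map_zero]
  | add z w hz hw => simp only [map_add, hz, hw]
  | tmul x n =>
    change P.left x (P.left a p) ⊗ₜ n = P.left (x * a) p ⊗ₜ n
    rw [map_mul]
    rfl

theorem GPrebimodule.actTensor_generates {P : GPrebimodule α β} (hP : ActionGenerates P.left)
    (N : Type*) [AddCommGroup N] [Module k N] : Generates (P.actTensor N) := fun S hS x => by
  induction x with
  | zero => exact S.zero_mem
  | add x y hx hy => exact S.add_mem hx hy
  | tmul p n =>
    exact hP (S.comap ((TensorProduct.mk k P.carrier N).flip n)) (fun a p => hS p (a ⊗ₜ n)) p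

namespace GMoritaContext

variable (c : GMoritaContext α β)

/-- The map `A ⊗ Q → A ⊗ Bᵒᵖ`, `a ⊗ q ↦ a ⊗ h(q, p)`, for `p` in `P`. -/
noncomputable def contract : c.P.carrier →ₗ[k] A ⊗[k] c.Q.carrier →ₗ[k] A ⊗[k] Bᵐᵒᵖ :=
  LinearMap.lTensorHom A ∘ₗ
    (c.h.bilin.compr₂ (MulOpposite.opLinearEquiv k : B ≃ₗ[k] Bᵐᵒᵖ).toLinearMap).flip

theorem contract_tmul (p : c.P.carrier) (a : A) (q : c.Q.carrier) :
    c.contract p (a ⊗ₜ q) = a ⊗ₜ MulOpposite.op (c.h.bilin q p) := rfl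

theorem contract_left (a : A) (p : c.P.carrier) (x : A ⊗[k] c.Q.carrier) :
    c.contract (c.P.left a p) x =
      c.contract p (lTensorAction A c.Q.right (MulOpposite.op a) x) := by
  induction x with
  | zero => simp only [map_zero]
  | add x y hx hy => simp only [map_add, hx, hy]
  | tmul x q => simp only [contract_tmul, lTensorAction_tmul, c.h.balanced]

theorem contract_generates : Generates c.contract := fun S hS x => by
  induction x with
  | zero => exact S.zero_mem
  | add x y hx hy => exact S.add_mem hx hy
  | tmul a b =>
    exact c.h_generates (S.comap (TensorProduct.mk k A Bᵐᵒᵖ a ∘ₗ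
      (MulOpposite.opLinearEquiv k : B ≃ₗ[k] Bᵐᵒᵖ).toLinearMap))
      (fun q p => hS p (a ⊗ₜ q)) b.unop

theorem contract_equivariant (g : G) (p : c.P.carrier) (x : A ⊗[k] c.Q.carrier) :
    c.contract (c.P.rep g p) (α.rep.tprod c.Q.rep g x) =
      (α.rep.tprod β.op.rep) g (c.contract p x) := by
  induction x with
  | zero => simp only [map_zero]
  | add x y hx hy => simp only [map_add, hx, hy]
  | tmul x q =>
    exact congrArg (α.rep g x ⊗ₜ[k] MulOpposite.op ·) (c.h.equivariant g q p)

theorem faithfulSMul_P [FaithfulSMul k A] : FaithfulSMul k c.P.carrier where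
  eq_of_smul_eq_smul {r s} hrs := by
    refine FaithfulSMul.eq_of_smul_eq_smul (α := A) fun a => ?_
    induction a using c.f_generates.induction with
    | add a b ha hb => rw [smul_add, smul_add, ha, hb]
    | apply p q => rw [← LinearMap.smul_apply, ← map_smul, hrs, map_smul, LinearMap.smul_apply]

theorem exists_lift_contract [IsScalarTower k B B] [SMulCommClass k B B]
    (hB : IsFirm (NonUnitalAlgHom.lmul k B)) {R : Type u} [AddCommGroup R] [Module k R]
    (t : c.P.carrier →ₗ[k] A ⊗[k] c.Q.carrier →ₗ[k] R)
    (ht : ∀ a p z, t (c.P.left a p) z = t p (lTensorAction A c.Q.right (MulOpposite.op a) z)) :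
    ∃ ψ : A ⊗[k] Bᵐᵒᵖ →ₗ[k] R, ∀ p z, ψ (c.contract p z) = t p z := by
  let t' : c.Q.carrier →ₗ[k] c.P.carrier →ₗ[k] A →ₗ[k] R :=
    (LinearMap.lflip (R₀ := k)).toLinearMap ∘ₗ
      ((TensorProduct.mk k A c.Q.carrier).compr₂ t.flip).flip
  obtain ⟨s, hs⟩ := c.symm.exists_factor_f hB t' fun a q p =>
    LinearMap.ext fun x => (ht a p (x ⊗ₜ q)).symm
  refine ⟨TensorProduct.lift (s ∘ₗ (MulOpposite.opLinearEquiv k).symm.toLinearMap).flip,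
    fun p z => ?_⟩
  induction z with
  | zero => simp only [map_zero]
  | add z w hz hw => simp only [map_add, hz, hw]
  | tmul a q => exact LinearMap.congr_fun (hs q p) a

variable [IsScalarTower k A A] [SMulCommClass k A A]

theorem contract_right [IsScalarTower k B B] [SMulCommClass k B B] (a : A) (b : Bᵐᵒᵖ)
    (p : c.P.carrier) (x : A ⊗[k] c.Q.carrier) :
    c.contract (c.P.right b p) (tensorAction (NonUnitalAlgHom.lmul k A) c.Q.carrier a x) =
      (a ⊗ₜ b) * c.contract p x := by
  induction x with
  | zero => simp only [map_zero, mul_zero]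
  | add x y hx hy => simp only [map_add, mul_add, hx, hy]
  | tmul x q =>
    change (a * x) ⊗ₜ MulOpposite.op (c.h.bilin q (c.P.right (MulOpposite.op b.unop) p)) =
      (a ⊗ₜ b) * (x ⊗ₜ MulOpposite.op (c.h.bilin q p))
    rw [c.h.map_right, Algebra.TensorProduct.tmul_mul_tmul, MulOpposite.op_mul,
      MulOpposite.op_unop]

theorem exists_lift_actTensor (hP : IsFirm c.P.left) {N R : Type u} [AddCommGroup N] [Module k N]
    [AddCommGroup R] [Module k R] (t : c.P.carrier →ₗ[k] A ⊗[k] N →ₗ[k] R)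
    (ht : ∀ a p z, t (c.P.left a p) z =
      t p (tensorAction (rightRegular k A) N (MulOpposite.op a) z)) :
    ∃ φ : c.P.carrier ⊗[k] N →ₗ[k] R, ∀ p z, φ (c.P.actTensor N p z) = t p z := by
  let t' : A →ₗ[k] c.P.carrier →ₗ[k] N →ₗ[k] R :=
    (LinearMap.lflip (R₀ := k)).toLinearMap ∘ₗ (TensorProduct.mk k A N).compr₂ t.flip
  obtain ⟨s, hs⟩ := hP.exists_lift t' fun a b p => LinearMap.ext fun n => (ht b p (a ⊗ₜ n)).symm
  refine ⟨TensorProduct.lift s, fun p z => ?_⟩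
  induction z with
  | zero => simp only [map_zero]
  | add z w hz hw => simp only [map_add, hz, hw]
  | tmul a n => exact LinearMap.congr_fun (hs a p) n

theorem exists_equiv_of_equiv [IsScalarTower k B B] [SMulCommClass k B B]
    (hB : IsFirm (NonUnitalAlgHom.lmul k B)) (hP : IsFirm c.P.left) {N : Type u}
    [AddCommGroup N] [Module k N] (ε : A ⊗[k] N ≃ₗ[k] A ⊗[k] c.Q.carrier)
    (hε : ∀ a z, ε (tensorAction (rightRegular k A) N (MulOpposite.op a) z) =
      lTensorAction A c.Q.right (MulOpposite.op a) (ε z)) :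
    ∃ φ : c.P.carrier ⊗[k] N ≃ₗ[k] A ⊗[k] Bᵐᵒᵖ,
      ∀ p z, φ (c.P.actTensor N p z) = c.contract p (ε z) := by
  obtain ⟨φ, hφ⟩ := c.exists_lift_actTensor hP (c.contract.compl₂ ε.toLinearMap) fun a p z =>
    (c.contract_left a p (ε z)).trans (congrArg (c.contract p) (hε a z).symm)
  obtain ⟨ψ, hψ⟩ := c.exists_lift_contract hB ((c.P.actTensor N).compl₂ ε.symm.toLinearMap)
    fun a p x => by
      obtain ⟨z, rfl⟩ := ε.surjective x
      rw [← hε]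
      exact (c.P.actTensor_left a p _).trans (by simp)
  simp only [LinearMap.compl₂_apply, LinearEquiv.coe_coe] at hφ hψ
  refine ⟨LinearEquiv.ofLinearMap φ ψ (c.contract_generates.ext fun p x => ?_)
    ((GPrebimodule.actTensor_generates hP.generates N).ext fun p z => ?_), hφ⟩
  · rw [LinearMap.comp_apply, hψ, hφ, ε.apply_symm_apply, LinearMap.id_apply]
  · rw [LinearMap.comp_apply, hφ, hψ, ε.symm_apply_apply, LinearMap.id_apply]

end GMoritaContext

end Contraction

section Dual

variable {k : Type u} [CommRing k] {G : Type v} [Group G] {A B : Type u}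
  [NonUnitalRing A] [Module k A] [IsScalarTower k A A] [SMulCommClass k A A]
  [NonUnitalRing B] [Module k B]
  {α : AlgAction k G A} {β : AlgAction k G B}

theorem lmul_op_generates (hA : ActionGenerates (NonUnitalAlgHom.lmul k A)) :
    ActionGenerates (NonUnitalAlgHom.lmul k Aᵐᵒᵖ) := fun S hS x =>
  hA (S.comap (MulOpposite.opLinearEquiv k : A ≃ₗ[k] Aᵐᵒᵖ).toLinearMap)
    (fun a b => hS (MulOpposite.op b) (MulOpposite.op a)) x.unop

theorem rightRegular_generates (hA : ActionGenerates (NonUnitalAlgHom.lmul k A)) :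
    ActionGenerates (rightRegular k A) := fun S hS =>
  hA S fun a b => hS (MulOpposite.op b) a

theorem AlgAction.rep_envAction (α : AlgAction k G A) (g : G) (z : A ⊗[k] Aᵐᵒᵖ) (x : A) :
    α.rep g (envAction k A z x) = envAction k A ((α.tensor α.op).rep g z) (α.rep g x) := by
  rw [envAction_eq_commAction]
  exact map_commAction (fun a x => α.map_mul g a x) (fun b x => α.map_mul g x b.unop) z x

namespace GMoritaContext

variable (c : GMoritaContext α β)

/-- The `Aᵉ`-module `A ⊗ Q`. -/
noncomputable abbrev coeffAction : A ⊗[k] Aᵐᵒᵖ →ₙₐ[k] Module.End k (A ⊗[k] c.Q.carrier) :=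
  externalAction (NonUnitalAlgHom.lmul k A) c.Q.right

theorem isUnitalLeft_coeffAction (hA : IsFirm (NonUnitalAlgHom.lmul k A))
    (hQ : IsFirm c.Q.right) : IsUnitalLeft c.coeffAction :=
  isFirm_iff_isUnitalLeft.1 <| IsFirm.commAction hA.generates (lmul_op_generates hA.generates)
    (hA.tensorAction _) (hQ.lTensorAction _) _

theorem rep_coeffAction (g : G) (z : A ⊗[k] Aᵐᵒᵖ) (x : A ⊗[k] c.Q.carrier) :
    α.rep.tprod c.Q.rep g (c.coeffAction z x) =
      c.coeffAction ((α.tensor α.op).rep g z) (α.rep.tprod c.Q.rep g x) := by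
  refine map_commAction (f := α.rep.tprod c.Q.rep g) (fun a x => ?_) (fun b x => ?_) z x
  · induction x with
    | zero => simp only [map_zero]
    | add x y hx hy => simp only [map_add, hx, hy]
    | tmul x q => exact congrArg (· ⊗ₜ[k] c.Q.rep g q) (α.map_mul g a x)
  · induction x with
    | zero => simp only [map_zero]
    | add x y hx hy => simp only [map_add, hx, hy]
    | tmul x q => exact congrArg (α.rep g x ⊗ₜ[k] ·) (c.Q.rep_right g b.unop q)

/-- The `k`-module `Hom_{Aᵉ}(A, A ⊗ Q)`, which plays the role of the dual of `P`. -/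
noncomputable abbrev dual : Submodule k (A →ₗ[k] A ⊗[k] c.Q.carrier) :=
  homModule (envAction k A) c.coeffAction

variable {c} in
theorem map_commAction_of_mem_dual (η : c.dual) (z : A ⊗[k] Aᵐᵒᵖ) (x : A) :
    η.1 (commAction (NonUnitalAlgHom.lmul k A) (rightRegular k A) lmul_rightRegular_comm z x) =
      c.coeffAction z (η.1 x) :=
  envAction_eq_commAction (k := k) (A := A) ▸ η.2 z x

variable {c} in
theorem dual_mul_left (hA : ActionGenerates (NonUnitalAlgHom.lmul k A)) (η : c.dual) (a x : A) :
    η.1 (a * x) = tensorAction (NonUnitalAlgHom.lmul k A) c.Q.carrier a (η.1 x) :=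
  map_left_of_map_commAction hA (rightRegular_generates hA) (map_commAction_of_mem_dual η) a x

variable {c} in
theorem dual_mul_right (hA : ActionGenerates (NonUnitalAlgHom.lmul k A)) (η : c.dual) (x a : A) :
    η.1 (x * a) = lTensorAction A c.Q.right (MulOpposite.op a) (η.1 x) :=
  map_right_of_map_commAction hA (rightRegular_generates hA) (map_commAction_of_mem_dual η)
    (MulOpposite.op a) x

theorem exists_dualEquiv [IsScalarTower k B B] [SMulCommClass k B B] (hA : IsTaylorAzumaya k A)
    (hB : IsFirm (NonUnitalAlgHom.lmul k B)) (hP : IsFirm c.P.left) (hQ : IsFirm c.Q.right) :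
    ∃ φ : c.P.carrier ⊗[k] c.dual ≃ₗ[k] A ⊗[k] Bᵐᵒᵖ, ∀ a p (η : c.dual),
      φ (c.P.left a p ⊗ₜ η) = c.contract p (η.1 a) := by
  have hA' : IsFirm (NonUnitalAlgHom.lmul k A) := isFirm_iff_isUnitalLeft.2 hA.unital
  let ε : A ⊗[k] c.dual ≃ₗ[k] A ⊗[k] c.Q.carrier := LinearEquiv.ofBijective _
    (hA.counit_bijective _ c.coeffAction (c.isUnitalLeft_coeffAction hA' hQ))
  have hε (a : A) (z : A ⊗[k] c.dual) :
      ε (tensorAction (rightRegular k A) c.dual (MulOpposite.op a) z) =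
        lTensorAction A c.Q.right (MulOpposite.op a) (ε z) := by
    induction z with
    | zero => simp only [map_zero]
    | add z w hz hw => simp only [map_add, hz, hw]
    | tmul x η => exact dual_mul_right hA'.generates η x a
  obtain ⟨φ, hφ⟩ := c.exists_equiv_of_equiv (N := c.dual) hB hP ε hε
  exact ⟨φ, fun a p η => hφ p (a ⊗ₜ η)⟩

/-- The action of `G` on `Hom_{Aᵉ}(A, A ⊗ Q)` by conjugation. -/
noncomputable def dualRep : Representation k G c.dual where
  toFun g := (Representation.linHom α.rep (α.rep.tprod c.Q.rep) g).restrict fun η hη z x => by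
    change (α.rep.tprod c.Q.rep) g (η (α.rep g⁻¹ (envAction k A z x))) =
      c.coeffAction z ((α.rep.tprod c.Q.rep) g (η (α.rep g⁻¹ x)))
    rw [α.rep_envAction, hη, rep_coeffAction, Representation.self_inv_apply]
  map_one' := by
    ext1 η
    exact Subtype.ext (LinearMap.congr_fun
      (map_one (Representation.linHom α.rep (α.rep.tprod c.Q.rep))) η.1)
  map_mul' g h := by
    ext1 η
    exact Subtype.ext (LinearMap.congr_fun
      (map_mul (Representation.linHom α.rep (α.rep.tprod c.Q.rep)) g h) η.1)

theorem dualRep_apply (g : G) (η : c.dual) (x : A) :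
    (c.dualRep g η).1 (α.rep g x) = α.rep.tprod c.Q.rep g (η.1 x) := by
  change α.rep.tprod c.Q.rep g (η.1 (α.rep g⁻¹ (α.rep g x))) = _
  rw [Representation.inv_self_apply]

variable [IsScalarTower k B B] [SMulCommClass k B B]

/-- The left `A ⊗ Bᵒᵖ`-module `P`. -/
noncomputable abbrev biaction : A ⊗[k] Bᵐᵒᵖ →ₙₐ[k] Module.End k c.P.carrier :=
  commAction c.P.left c.P.right c.P.comm

theorem rep_biaction (g : G) (z : A ⊗[k] Bᵐᵒᵖ) (p : c.P.carrier) :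
    c.P.rep g (c.biaction z p) = c.biaction ((α.tensor β.op).rep g z) (c.P.rep g p) :=
  map_commAction (c.P.rep_left g) (fun b p => c.P.rep_right g b.unop p) z p

theorem exists_eq_smul_of_comm_biaction (hA : IsTaylorAzumaya k A) (κ : Module.End k c.P.carrier)
    (hκ : ∀ z p, κ (c.biaction z p) = c.biaction z (κ p)) : ∃ r : k, ∀ p, κ p = r • p := by
  have hl : ∀ a p, κ (c.P.left a p) = c.P.left a (κ p) :=
    map_left_of_map_commAction c.P_generates c.P_generates_right hκ
  have hr : ∀ b p, κ (c.P.right b p) = c.P.right b (κ p) :=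
    map_right_of_map_commAction c.P_generates c.P_generates_right hκ
  obtain ⟨θ, hθ⟩ := c.exists_factor_f (isFirm_iff_isUnitalLeft.2 hA.unital) (c.f.bilin ∘ₗ κ)
    fun b p q => by rw [LinearMap.comp_apply, hr, c.f.balanced]; rfl
  simp only [LinearMap.comp_apply] at hθ
  obtain ⟨r, hr'⟩ := hA.exists_eq_smul (θ := θ)
    (fun a x => by
      induction x using c.f_generates.induction with
      | add x y hx hy => simp only [mul_add, map_add, hx, hy]
      | apply p q => rw [← c.f.map_left, hθ, hθ, hl, c.f.map_left])
    (fun a x => by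
      induction x using c.f_generates.induction with
      | add x y hx hy => simp only [add_mul, map_add, hx, hy]
      | apply p q => rw [← c.f.map_right, hθ, hθ, c.f.map_right])
  refine ⟨r, fun p => ?_⟩
  induction p using c.P_generates.induction with
  | add p q hp hq => rw [map_add, hp, hq, smul_add]
  | apply a p' =>
    induction a using c.f_generates.induction with
    | add a b ha hb => simp only [map_add, LinearMap.add_apply, smul_add, ha, hb]
    | apply p q =>
      change κ (c.P.left (c.f.bilin p q) p') = r • c.P.left (c.f.bilin p q) p'
      rw [c.assoc_P, hr, ← c.assoc_P, ← hθ, hr', map_smul, LinearMap.smul_apply, c.assoc_P]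

section Elementary

variable {N : Type u} [AddCommGroup N] [Module k N] (φ : c.P.carrier ⊗[k] N ≃ₗ[k] A ⊗[k] Bᵐᵒᵖ)

theorem exists_pairing (hA : IsTaylorAzumaya k A)
    (hφ : ∀ z x η, φ (c.biaction z x ⊗ₜ η) = z * φ (x ⊗ₜ η)) :
    ∃ μ : N ⊗[k] c.P.carrier →ₗ[k] k,
      ∀ η p x, c.biaction (φ (x ⊗ₜ η)) p = μ (η ⊗ₜ p) • x := by
  have := hA.faithful
  have := c.faithfulSMul_P
  let T : N →ₗ[k] c.P.carrier →ₗ[k] Module.End k c.P.carrier :=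
    LinearMap.mk₂ k (fun η p => (c.biaction : A ⊗[k] Bᵐᵒᵖ →ₗ[k] Module.End k c.P.carrier).flip p ∘ₗ
        φ.toLinearMap ∘ₗ (TensorProduct.mk k c.P.carrier N).flip η)
      (fun _ _ _ => by ext; simp) (fun _ _ _ => by ext; simp)
      (fun _ _ _ => by ext; simp) (fun _ _ _ => by ext; simp)
  refine exists_eq_smul_of_forall_exists T fun η p =>
    c.exists_eq_smul_of_comm_biaction hA (T η p) fun z x => ?_
  change c.biaction (φ (c.biaction z x ⊗ₜ η)) p = c.biaction z (c.biaction (φ (x ⊗ₜ η)) p)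
  rw [hφ, map_mul]
  rfl

theorem pairing_surjective (hA : IsTaylorAzumaya k A) {μ : N ⊗[k] c.P.carrier →ₗ[k] k}
    (hμ : ∀ η p x, c.biaction (φ (x ⊗ₜ η)) p = μ (η ⊗ₜ p) • x) : Function.Surjective μ := by
  let I : Ideal k := LinearMap.range μ
  have biaction_mem (z : A ⊗[k] Bᵐᵒᵖ) (p : c.P.carrier) :
      c.biaction z p ∈ I • (⊤ : Submodule k c.P.carrier) := by
    obtain ⟨t, rfl⟩ := φ.surjective z
    induction t with
    | zero => simp only [map_zero, LinearMap.zero_apply, zero_mem]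
    | add t t' ht ht' => simpa only [map_add, LinearMap.add_apply] using add_mem ht ht'
    | tmul x η =>
      exact hμ η p x ▸ Submodule.smul_mem_smul (LinearMap.mem_range_self μ _) Submodule.mem_top
  have mem_P (p : c.P.carrier) : p ∈ I • (⊤ : Submodule k c.P.carrier) :=
    c.P_generates.commAction c.P_generates_right c.P.comm _ biaction_mem p
  refine LinearMap.range_eq_top.1 <| hA.eq_top_of_smul_eq_top (I := I) <| eq_top_iff.2 fun a _ =>
    c.f_generates _ (fun p q => ?_) a
  have : (I • (⊤ : Submodule k c.P.carrier)).map (c.f.bilin.flip q) ≤ I • ⊤ := by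
    rw [Submodule.map_smul'']
    exact Submodule.smul_mono le_rfl le_top
  exact this (Submodule.mem_map_of_mem (mem_P p))

theorem isElementary_of_linearEquiv (hA : IsTaylorAzumaya k A) (ν : Representation k G N)
    (hφ : ∀ z x η, φ (c.biaction z x ⊗ₜ η) = z * φ (x ⊗ₜ η))
    (hφg : ∀ g x η, φ (c.P.rep g x ⊗ₜ ν g η) = (α.tensor β.op).rep g (φ (x ⊗ₜ η))) :
    IsElementary (α.tensor β.op) := by
  have := hA.faithful
  have := c.faithfulSMul_P
  obtain ⟨μ, hμ⟩ := c.exists_pairing φ hA hφ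
  let D : GDualPair k G :=
    { M := c.P.carrier
      M' := N
      μ := μ
      surjective := c.pairing_surjective φ hA hμ
      rep := c.P.rep
      rep' := ν
      invariant := fun g η p => FaithfulSMul.eq_of_smul_eq_smul (α := c.P.carrier) fun x => by
        rw [← hμ, ← Representation.self_inv_apply c.P.rep g x, hφg, ← rep_biaction, hμ,
          map_smul] }
  have generates := Elem.tmulBilin_generates D.toDualPair
  let e : D.algAction.Iso (α.tensor β.op) :=
    { toEquiv := φ
      map_mul := map_mul_of_generates (A := Elem D.toDualPair) (B := A ⊗[k] Bᵐᵒᵖ)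
        (f := φ.toLinearMap) generates fun x η y θ => by
          refine (congrArg φ (Elem.tmul_mul_tmul D.toDualPair x y η θ)).trans ?_
          change φ (μ (η ⊗ₜ y) • (x ⊗ₜ[k] θ)) = φ (x ⊗ₜ η) * φ (y ⊗ₜ θ)
          rw [← hφ, hμ, TensorProduct.smul_tmul']
      equivariant := fun g => LinearMap.congr_fun (f := φ.toLinearMap ∘ₗ D.algAction.rep g)
        (g := (α.tensor β.op).rep g ∘ₗ φ.toLinearMap) (generates.ext fun x η => hφg g x η) }
  exact ⟨D, ⟨e.symm⟩⟩

end Elementary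

theorem isElementary (hA : IsTaylorAzumaya k A) (hB : IsFirm (NonUnitalAlgHom.lmul k B))
    (hP : IsFirm c.P.left) (hQ : IsFirm c.Q.right) : IsElementary (α.tensor β.op) := by
  have hA' : IsFirm (NonUnitalAlgHom.lmul k A) := isFirm_iff_isUnitalLeft.2 hA.unital
  obtain ⟨φ, hφ⟩ := c.exists_dualEquiv hA hB hP hQ
  refine c.isElementary_of_linearEquiv (N := c.dual) φ hA c.dualRep
    (fun z x η => ?_) fun g x η => ?_
  · induction z with
    | zero => simp only [map_zero, LinearMap.zero_apply, TensorProduct.zero_tmul, zero_mul]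
    | add z w hz hw =>
      simp only [map_add, LinearMap.add_apply, TensorProduct.add_tmul, add_mul, hz, hw]
    | tmul a b =>
      induction x using c.P_generates.induction with
      | add x y hx hy => simp only [map_add, TensorProduct.add_tmul, mul_add, hx, hy]
      | apply d p =>
        have left_right_left :
            c.P.left a (c.P.right b (c.P.left d p)) = c.P.left (a * d) (c.P.right b p) := by
          rw [← c.P.comm, map_mul]
          rfl
        rw [commAction_tmul, left_right_left, hφ, hφ, dual_mul_left hA'.generates, contract_right]
  · induction x using c.P_generates.induction with
    | add x y hx hy => simp only [map_add, TensorProduct.add_tmul, hx, hy]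
    | apply a p =>
      rw [c.P.rep_left, hφ, hφ, dualRep_apply, contract_equivariant]
      rfl

end GMoritaContext

/-- The context underlying a Morita equivalence. -/
def StrictGMoritaContext.toGMoritaContext [IsScalarTower k B B] [SMulCommClass k B B]
    (c : StrictGMoritaContext α β) : GMoritaContext α β where
  P := { c.P with }
  Q := { c.Q with }
  f :=
    { bilin := (BalancedTensor.mk c.P.right c.Q.left).compr₂ c.f
      balanced := fun b p q => congrArg c.f (BalancedTensor.mk_balanced _ _ b p q)
      map_left := c.f_left
      map_right := c.f_right
      equivariant := c.f_equivariant }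
  h :=
    { bilin := (BalancedTensor.mk c.Q.right c.P.left).compr₂ c.h
      balanced := fun a q p => congrArg c.h (BalancedTensor.mk_balanced _ _ a q p)
      map_left := c.h_left
      map_right := c.h_right
      equivariant := c.h_equivariant }
  assoc_P := c.assoc_P
  assoc_Q := c.assoc_Q
  P_generates := (isFirm_iff_isUnitalLeft.2 c.P.unital_left).generates
  Q_generates := (isFirm_iff_isUnitalLeft.2 c.Q.unital_left).generates
  f_generates S hS a := by
    obtain ⟨t, rfl⟩ := c.f_bijective.surjective a
    exact BalancedTensor.generates_mk _ _ (S.comap c.f) hS t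
  h_generates S hS b := by
    obtain ⟨t, rfl⟩ := c.h_bijective.surjective b
    exact BalancedTensor.generates_mk _ _ (S.comap c.h) hS t

theorem isElementary_enveloping (hA : IsTaylorAzumaya k A) : IsElementary (α.tensor α.op) :=
  have hA' : IsFirm (NonUnitalAlgHom.lmul k A) := isFirm_iff_isUnitalLeft.2 hA.unital
  let c := GMoritaContext.ofIso (AlgAction.Iso.refl α) hA'.generates
  have hP : IsFirm c.P.left := GPrebimodule.isFirm_ofIso_left _ hA'
  c.isElementary hA hA' hP (c.symm.isFirm_right hA' hP)

end Dual

end EquivariantBrauer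

open EquivariantBrauer in
theorem proposition2p1_general {k : Type u} [CommRing k] {G : Type v} [Group G] {A B : Type u}
    [NonUnitalRing A] [Module k A] [IsScalarTower k A A] [SMulCommClass k A A]
    [NonUnitalRing B] [Module k B] [IsScalarTower k B B] [SMulCommClass k B B]
    (α : AlgAction k G A) (β : AlgAction k G B)
    (hA : IsTaylorAzumaya k A) (hB : IsUnitalAlgebra k B) :
    List.TFAE [
      Nonempty (StrictGMoritaContext α β),
      IsElementary (α.tensor β.op),
      ∃ M N : GDualPair k G,
        Nonempty ((α.tensor M.algAction).Iso (β.tensor N.algAction))] := by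
  have hA' : IsFirm (NonUnitalAlgHom.lmul k A) := isFirm_iff_isUnitalLeft.2 hA.unital
  have hB' : IsFirm (NonUnitalAlgHom.lmul k B) := isFirm_iff_isUnitalLeft.2 hB
  tfae_have 1 → 2 := fun ⟨c⟩ => c.toGMoritaContext.isElementary hA hB'
    (isFirm_iff_isUnitalLeft.2 c.P.unital_left) (isFirm_iff_isUnitalRight.2 c.Q.unital_right)
  tfae_have 2 → 3 := fun h => by
    obtain ⟨M, ⟨e⟩⟩ := h.tensor_op_swap
    obtain ⟨N, ⟨d⟩⟩ := isElementary_enveloping (α := α) hA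
    exact ⟨M, N, ⟨((e.symm.lTensor α).trans (.leftComm α β α.op)).trans (d.lTensor β)⟩⟩
  tfae_have 3 → 1 := fun ⟨_, _, ⟨e⟩⟩ => moritaEquivalent_of_iso_tensor_elementary hA' hB' e
  tfae_finish

theorem proposition2p1 {k : Type u} [CommRing k] {G : Type v} [Group G] {A B : Type u}
    [NonUnitalRing A] [Module k A] [IsScalarTower k A A] [SMulCommClass k A A]
    [NonUnitalRing B] [Module k B] [IsScalarTower k B B] [SMulCommClass k B B]
    (α : EquivariantBrauer.AlgAction k G A) (β : EquivariantBrauer.AlgAction k G B)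
    (hA : EquivariantBrauer.IsTaylorAzumaya k A) (hB : EquivariantBrauer.IsTaylorAzumaya k B) :
    List.TFAE [
      Nonempty (EquivariantBrauer.StrictGMoritaContext α β),
      EquivariantBrauer.IsElementary (α.tensor β.op),
      ∃ M N : EquivariantBrauer.GDualPair k G,
        Nonempty ((α.tensor M.algAction).Iso (β.tensor N.algAction))] :=
  proposition2p1_general α β hA hB.unital
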